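/- We work in classical foundations; categories are not required to be univalent unless this is said. **Displayed categories.** A displayed category $D$ over a category $C$ has a collection $D_x$ of objects over each $x\in C$ and, for $f:x\to y$, $A\in D_x$, $B\in D_y$, a set of morphisms over $f$ from $A$ to $B$, with identities and composition lying over those of $C$. Its fiber $D_x$ is the category of objects over $x$ and morphisms over $\mathrm{id}_x$. A displayed functor $\overline F:D_1\to D_2$ over $F:C_1\to C_2$ induces functors $\overline F_x:(D_1)_x\to(D_2)_{F(x)}$, and is Cartesian if it preserves Cartesian morphisms. $\mathrm{Arr}(C)$ is the displayed category over $C$ whose objects over $y$ are the morphisms with codomain $y$ and whose morphisms over $f$ are the commutative squares with bottom side $f$. Functors and natural transformations act on it; the results are written $\mathrm{Arr}(F)$ and $\mathrm{Arr}(\tau)$. **DFL comprehension categories.** A full comprehension category $\chi:D\to\mathrm{Arr}(C)$ consists of a category $C$ with a terminal object $[\,]$, a displayed category $D$ over $C$ that has a cleaving, and a displayed functor $\chi:D\to\mathrm{Arr}(C)$ over $\mathrm{id}_C$ that is Cartesian and fully faithful. For $A\in D_\Gamma$ write $\chi(A)=(\pi_A:\Gamma.A\to\Gamma)$. It is DFL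 if * (unit types) the fibers $D_\Gamma$ have terminal objects $1_\Gamma$, which the pullback functors $f^*$ preserve, and each $\pi_{1_\Gamma}$ is an isomorphism; * (products, equalizers) the fibers have binary products and equalizers, which the pullback functors preserve; * (strong $\Sigma$-types) each $\pi_A^*:D_\Gamma\to D_{\Gamma.A}$ has a left adjoint $\Sigma_A$ with unit $\eta$, the Beck–Chevalley condition holds for each pullback square of a projection $\pi_A$ whose opposite side is also a projection, and the composite $\Gamma.A.B\to\Gamma.A.\pi_A^*(\Sigma_A B)\to\Gamma.\Sigma_A B$ of the map induced by $\eta_B$ and the map induced by the Cartesian lift is an isomorphism for all $A\in D_\Gamma$ and $B\in D_{\Gamma.A}$; * (democracy) for each $\Gamma\in C$ there is $\overline\Gamma\in D_{[\,]}$ with $\Gamma\cong[\,].\overline\Gamma$. $\mathsf{DFLCompCat}$ is the following bicategory. Its objects are the DFL comprehension categories. A 1-cell from $\chi_1:D_1\to\mathrm{Arr}(C_1)$ to $\chi_2:D_2\to\mathrm{Arr}(C_2)$ is a triple $(F,\overline F,F_\chi)$ of a functor $F:C_1\to C_2$ that preserves terminal objects, a Cartesian displayed functor $\overline F:D_1\to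 D_2$ over $F$ such that every $\overline F_x$ preserves terminal objects, binary products and equalizers, and a displayed natural isomorphism $F_\chi:\mathrm{Arr}(F)\circ\chi_1\Rightarrow\chi_2\circ\overline F$ over $\mathrm{id}_F$. A 2-cell $(F,\overline F,F_\chi)\Rightarrow(G,\overline G,G_\chi)$ is a natural transformation $\tau:F\Rightarrow G$ with a displayed natural transformation $\overline\tau:\overline F\Rightarrow\overline G$ over $\tau$ such that $\chi_2(\overline\tau_A)\circ F_\chi(A)=G_\chi(A)\circ\mathrm{Arr}(\tau)_{\chi_1(A)}$ for all $A$. $\mathsf{FinLim}$ is the bicategory of categories with finite limits, functors that preserve them, and natural transformations. **Proposition.** 1. The assignments $C\mapsto(\mathrm{id}:\mathrm{Arr}(C)\to\mathrm{Arr}(C))$, $F\mapsto(F,\mathrm{Arr}(F),\mathrm{id})$, $\tau\mapsto(\tau,\mathrm{Arr}(\tau))$ form a pseudofunctor $H:\mathsf{FinLim}\to\mathsf{DFLCompCat}$, and $(\chi:D\to\mathrm{Arr}(C))\mapsto C$, $(F,\overline F,F_\chi)\mapsto F$, $(\tau,\overline\tau)\mapsto\tau$ form a pseudofunctor $U:\mathsf{DFLCompCat}\to\mathsf{FinLim}$.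 The 1-cells $\zeta_\chi=(\mathrm{id}_C,\chi,\mathrm{id})$ from $\chi:D\to\mathrm{Arr}(C)$ to $\mathrm{id}:\mathrm{Arr}(C)\to\mathrm{Arr}(C)$, with naturality squares given by $\mathrm{id}_F$ and $F_\chi$, form a pseudotransformation $\zeta:\mathrm{id}_{\mathsf{DFLCompCat}}\Rightarrow U\cdot H$, where $U\cdot H$ means first $U$ and then $H$. 2. The pseudotransformation $\zeta$ is a pointwise adjoint equivalence: for every DFL comprehension category $\chi$, the 1-cell $\zeta_\chi$ is an adjoint equivalence in $\mathsf{DFLCompCat}$. 3. If $C\in\mathsf{FinLim}$ is univalent (for all $x,y$, the map from equalities $x=y$ to isomorphisms $x\cong y$ is bijective), then so is $H(C)$, that is, $C$ and all the fibers of $\mathrm{Arr}(C)$ are univalent. Hence the statement also holds for the full sub-bicategories on the univalent objects. -/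

import Mathlib

open CategoryTheory CategoryTheory.Limits

set_option linter.checkUnivs false

universe w' w v u w₁' w₁ v₁ u₁ w₂' w₂ v₂ u₂ w₃' w₃ v₃ u₃

namespace CompLang

/-! ### Displayed categories, functors and natural transformations -/

/-- A displayed category over `C`. The laws of composition relate displayed morphisms over equal
morphisms of `C`, hence they are heterogeneous equalities. -/
structure DispCat (C : Type u) [Category.{v} C] where
  Obj : C → Type w
  Hom : ∀ {x y : C}, (x ⟶ y) → Obj x → Obj y → Type w'
  id : ∀ {x : C} (a : Obj x), Hom (𝟙 x) a a
  comp : ∀ {x y z : C} {f : x ⟶ y} {g : y ⟶ z} {a : Obj x} {b : Obj y} {c : Obj z},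
    Hom f a b → Hom g b c → Hom (f ≫ g) a c
  id_comp : ∀ {x y : C} {f : x ⟶ y} {a : Obj x} {b : Obj y} (φ : Hom f a b),
    HEq (comp (id a) φ) φ
  comp_id : ∀ {x y : C} {f : x ⟶ y} {a : Obj x} {b : Obj y} (φ : Hom f a b),
    HEq (comp φ (id b)) φ
  assoc : ∀ {x y z t : C} {f : x ⟶ y} {g : y ⟶ z} {h : z ⟶ t}
    {a : Obj x} {b : Obj y} {c : Obj z} {d : Obj t}
    (φ : Hom f a b) (ψ : Hom g b c) (θ : Hom h c d),
    HEq (comp (comp φ ψ) θ) (comp φ (comp ψ θ))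

namespace DispCat

variable {C : Type u} [Category.{v} C] (D : DispCat.{w', w} C)

/-- Transport of displayed morphisms along an equality of morphisms of the base. -/
def tr {x y : C} {f g : x ⟶ y} (h : f = g) {a : D.Obj x} {b : D.Obj y} (φ : D.Hom f a b) :
    D.Hom g a b :=
  h ▸ φ

theorem tr_heq {x y : C} {f g : x ⟶ y} (h : f = g) {a : D.Obj x} {b : D.Obj y}
    (φ : D.Hom f a b) : HEq (D.tr h φ) φ := by
  subst h; rfl

theorem comp_heq {x y z : C} {f f' : x ⟶ y} {g g' : y ⟶ z} {a : D.Obj x} {b : D.Obj y}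
    {c : D.Obj z} {φ : D.Hom f a b} {φ' : D.Hom f' a b} {ψ : D.Hom g b c} {ψ' : D.Hom g' b c}
    (hf : f = f') (hφ : HEq φ φ') (hg : g = g') (hψ : HEq ψ ψ') :
    HEq (D.comp φ ψ) (D.comp φ' ψ') := by
  subst hf hg; cases hφ; cases hψ; rfl

/-- The objects of the fiber category of `D` over `x`. -/
abbrev Fiber (x : C) : Type w := D.Obj x

/-- The fiber category: morphisms are the displayed morphisms over the identity. -/
instance fiberCategory (x : C) : Category.{w'} (D.Fiber x) where
  Hom a b := D.Hom (𝟙 x) a b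
  id a := D.id a
  comp φ ψ := D.tr (Category.id_comp (𝟙 x)) (D.comp φ ψ)
  id_comp φ := eq_of_heq ((D.tr_heq _ _).trans (D.id_comp φ))
  comp_id φ := eq_of_heq ((D.tr_heq _ _).trans (D.comp_id φ))
  assoc φ ψ θ := by
    have h := Category.id_comp (𝟙 x)
    refine eq_of_heq ((D.tr_heq _ _).trans (HEq.trans ?_ (D.tr_heq _ _).symm))
    refine (D.comp_heq h.symm (D.tr_heq h _) rfl HEq.rfl).trans ((D.assoc φ ψ θ).trans ?_)
    exact D.comp_heq rfl HEq.rfl h (D.tr_heq h _).symm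

theorem fiber_comp_heq {x : C} {a b c : D.Fiber x} (φ : a ⟶ b) (ψ : b ⟶ c) :
    HEq (φ ≫ ψ) (D.comp (f := 𝟙 x) (g := 𝟙 x) φ ψ) :=
  D.tr_heq _ _

/-- A displayed morphism `φ` over `f : x ⟶ y` is Cartesian if every displayed morphism over
`g ≫ f` factors uniquely through `φ` by a displayed morphism over `g`. -/
def IsCartesian {x y : C} {f : x ⟶ y} {a : D.Obj x} {b : D.Obj y} (φ : D.Hom f a b) : Prop :=
  ∀ ⦃t : C⦄ (c : D.Obj t) (g : t ⟶ x) (ψ : D.Hom (g ≫ f) c b),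
    ∃! θ : D.Hom g c a, D.comp θ φ = ψ

/-- A cleaving: a choice of Cartesian lifts. -/
structure Cleaving where
  obj : ∀ {x y : C} (_ : x ⟶ y), D.Obj y → D.Obj x
  lift : ∀ {x y : C} (f : x ⟶ y) (b : D.Obj y), D.Hom f (obj f b) b
  cart : ∀ {x y : C} (f : x ⟶ y) (b : D.Obj y), D.IsCartesian (lift f b)

section Cartesian

variable {D} {x y : C} {f : x ⟶ y} {a : D.Obj x} {b : D.Obj y} {φ : D.Hom f a b}

/-- The factorization through a Cartesian morphism. -/
noncomputable def IsCartesian.factor (h : D.IsCartesian φ) {t : C} {c : D.Obj t} {g : t ⟶ x}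
    {k : t ⟶ y} (e : k = g ≫ f) (ψ : D.Hom k c b) : D.Hom g c a :=
  (h c g (D.tr e ψ)).choose

theorem IsCartesian.factor_comp (h : D.IsCartesian φ) {t : C} {c : D.Obj t} {g : t ⟶ x}
    {k : t ⟶ y} (e : k = g ≫ f) (ψ : D.Hom k c b) : HEq (D.comp (h.factor e ψ) φ) ψ :=
  (heq_of_eq (h c g (D.tr e ψ)).choose_spec.1).trans (D.tr_heq _ _)

theorem IsCartesian.hom_ext (h : D.IsCartesian φ) {t : C} {c : D.Obj t} {g : t ⟶ x}
    {θ θ' : D.Hom g c a} (e : HEq (D.comp θ φ) (D.comp θ' φ)) : θ = θ' :=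
  (h c g (D.comp θ' φ)).unique (eq_of_heq e) rfl

end Cartesian

namespace Cleaving

variable {D} (K : D.Cleaving)

/-- The pullback functor `f^*` between fibers. -/
noncomputable def pullback {x y : C} (f : x ⟶ y) : D.Fiber y ⥤ D.Fiber x where
  obj b := K.obj f b
  map {b c} φ := (K.cart f c).factor (k := f ≫ 𝟙 y) (g := 𝟙 x)
    ((Category.comp_id f).trans (Category.id_comp f).symm) (D.comp (K.lift f b) φ)
  map_id b := (K.cart f b).hom_ext
    (((K.cart f b).factor_comp _ _).trans ((D.comp_id _).trans (D.id_comp _).symm))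
  map_comp {b c d} φ ψ := by
    have h₀ : f ≫ 𝟙 y = 𝟙 x ≫ f := (Category.comp_id f).trans (Category.id_comp f).symm
    have h₁ := Category.id_comp (𝟙 x)
    have h₂ := Category.id_comp (𝟙 y)
    refine (K.cart f d).hom_ext (((K.cart f d).factor_comp _ _).trans ?_)
    refine (D.comp_heq rfl HEq.rfl h₂.symm (D.fiber_comp_heq _ _)).trans ?_
    refine HEq.trans ?_ (D.comp_heq h₁.symm (D.fiber_comp_heq _ _) rfl HEq.rfl).symm
    refine (D.assoc _ _ _).symm.trans (HEq.trans ?_ (D.assoc _ _ _).symm)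
    refine HEq.trans ?_ (D.comp_heq rfl HEq.rfl h₀ ((K.cart f d).factor_comp _ _).symm)
    refine HEq.trans ?_ (D.assoc _ _ _)
    exact D.comp_heq h₀ ((K.cart f c).factor_comp _ _).symm rfl HEq.rfl

theorem pullback_map_lift {x y : C} (f : x ⟶ y) {b c : D.Fiber y} (φ : b ⟶ c) :
    HEq (D.comp (f := 𝟙 x) ((K.pullback f).map φ) (K.lift f c))
      (D.comp (g := 𝟙 y) (K.lift f b) φ) :=
  (K.cart f c).factor_comp _ _

/-- The comparison `s^* (p^* b) ⟶ q^* (r^* b)` for a commutative square `s ≫ p = q ≫ r`: the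
unique morphism over the identity that is compatible with the Cartesian lifts. -/
noncomputable def squareApp {x' x z' z : C} {s : x' ⟶ x} {p : x ⟶ z} {q : x' ⟶ z'} {r : z' ⟶ z}
    (w : s ≫ p = q ≫ r) (b : D.Obj z) :
    D.Hom (𝟙 x') (K.obj s (K.obj p b)) (K.obj q (K.obj r b)) :=
  (K.cart q _).factor (Category.id_comp q).symm
    ((K.cart r b).factor w (D.comp (K.lift s _) (K.lift p b)))

theorem squareApp_lift {x' x z' z : C} {s : x' ⟶ x} {p : x ⟶ z} {q : x' ⟶ z'} {r : z' ⟶ z}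
    (w : s ≫ p = q ≫ r) (b : D.Obj z) :
    HEq (D.comp (D.comp (K.squareApp w b) (K.lift q _)) (K.lift r b))
      (D.comp (K.lift s _) (K.lift p b)) :=
  (D.comp_heq (Category.id_comp q) ((K.cart q _).factor_comp _ _) rfl HEq.rfl).trans
    ((K.cart r b).factor_comp w _)

/-- The canonical transformation `p^* ⋙ s^* ⟶ r^* ⋙ q^*` for a commutative square. -/
noncomputable def square {x' x z' z : C} {s : x' ⟶ x} {p : x ⟶ z} {q : x' ⟶ z'} {r : z' ⟶ z}
    (w : s ≫ p = q ≫ r) : K.pullback p ⋙ K.pullback s ⟶ K.pullback r ⋙ K.pullback q where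
  app b := K.squareApp w b
  naturality b c φ := by
    change D.Fiber z at b c
    let A : D.Hom (𝟙 x') (K.obj s (K.obj p b)) (K.obj s (K.obj p c)) :=
      (K.pullback s).map ((K.pullback p).map φ)
    let A' : D.Hom (𝟙 x) (K.obj p b) (K.obj p c) := (K.pullback p).map φ
    let B : D.Hom (𝟙 x') (K.obj q (K.obj r b)) (K.obj q (K.obj r c)) :=
      (K.pullback q).map ((K.pullback r).map φ)
    let B' : D.Hom (𝟙 z') (K.obj r b) (K.obj r c) := (K.pullback r).map φ
    let φ' : D.Hom (𝟙 z) b c := φ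
    have hA : HEq (D.comp A (K.lift s _)) (D.comp (K.lift s _) A') := K.pullback_map_lift s _
    have hA' : HEq (D.comp A' (K.lift p _)) (D.comp (K.lift p _) φ') := K.pullback_map_lift p φ
    have hB : HEq (D.comp B (K.lift q _)) (D.comp (K.lift q _) B') := K.pullback_map_lift q _
    have hB' : HEq (D.comp B' (K.lift r _)) (D.comp (K.lift r _) φ') := K.pullback_map_lift r φ
    have hb := K.squareApp_lift w b
    have hc := K.squareApp_lift w c
    have i₁ := Category.id_comp (𝟙 x')
    refine (K.cart q _).hom_ext (heq_of_eq ((K.cart r c).hom_ext ?_))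
    have e₁ : HEq (D.comp (D.comp (D.comp A (K.squareApp w c)) (K.lift q _)) (K.lift r c))
        (D.comp (K.lift s _) (D.comp (K.lift p b) φ')) := by
      refine (D.comp_heq (Category.assoc _ _ _) (D.assoc _ _ _) rfl HEq.rfl).trans ?_
      refine (D.assoc _ _ _).trans ?_
      refine (D.comp_heq rfl HEq.rfl (by simpa using w.symm) hc).trans ?_
      refine (D.assoc _ _ _).symm.trans ?_
      refine (D.comp_heq (by simp) hA rfl HEq.rfl).trans ?_
      refine (D.assoc _ _ _).trans ?_
      exact D.comp_heq rfl HEq.rfl (by simp) hA'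
    have e₂ : HEq (D.comp (D.comp (D.comp (K.squareApp w b) B) (K.lift q _)) (K.lift r c))
        (D.comp (K.lift s _) (D.comp (K.lift p b) φ')) := by
      refine (D.comp_heq (Category.assoc _ _ _) (D.assoc _ _ _) rfl HEq.rfl).trans ?_
      refine (D.comp_heq (by simp) (D.comp_heq rfl HEq.rfl (by simp) hB) rfl HEq.rfl).trans ?_
      refine (D.comp_heq (by simp) (D.assoc _ _ _).symm rfl HEq.rfl).trans ?_
      refine (D.assoc _ _ _).trans ?_
      refine (D.comp_heq rfl HEq.rfl (by simp) hB').trans ?_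
      refine (D.assoc _ _ _).symm.trans ?_
      refine (D.comp_heq (by simpa using w.symm) hb rfl HEq.rfl).trans ?_
      exact D.assoc _ _ _
    refine (D.comp_heq (by simp) (D.comp_heq i₁.symm (D.fiber_comp_heq _ _) rfl HEq.rfl) rfl
      HEq.rfl).trans (e₁.trans (e₂.symm.trans ?_))
    exact D.comp_heq (by simp) (D.comp_heq i₁ (D.fiber_comp_heq _ _).symm rfl HEq.rfl) rfl HEq.rfl

end Cleaving

end DispCat

/-- A displayed functor over `F`. -/
structure DispFunctor {C : Type u₁} [Category.{v₁} C] {C' : Type u₂} [Category.{v₂} C']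
    (F : C ⥤ C') (D : DispCat.{w₁', w₁} C) (D' : DispCat.{w₂', w₂} C') where
  obj : ∀ {x : C}, D.Obj x → D'.Obj (F.obj x)
  map : ∀ {x y : C} {f : x ⟶ y} {a : D.Obj x} {b : D.Obj y},
    D.Hom f a b → D'.Hom (F.map f) (obj a) (obj b)
  map_id : ∀ {x : C} (a : D.Obj x), HEq (map (D.id a)) (D'.id (obj a))
  map_comp : ∀ {x y z : C} {f : x ⟶ y} {g : y ⟶ z} {a : D.Obj x} {b : D.Obj y} {c : D.Obj z}
    (φ : D.Hom f a b) (ψ : D.Hom g b c),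
    HEq (map (D.comp φ ψ)) (D'.comp (map φ) (map ψ))

/-- A displayed natural transformation over `τ`. -/
structure DispNatTrans {C : Type u₁} [Category.{v₁} C] {C' : Type u₂} [Category.{v₂} C']
    {D : DispCat.{w₁', w₁} C} {D' : DispCat.{w₂', w₂} C'} {F G : C ⥤ C'} (τ : F ⟶ G)
    (F' : DispFunctor F D D') (G' : DispFunctor G D D') where
  app : ∀ {x : C} (a : D.Obj x), D'.Hom (τ.app x) (F'.obj a) (G'.obj a)
  naturality : ∀ {x y : C} {f : x ⟶ y} {a : D.Obj x} {b : D.Obj y} (φ : D.Hom f a b),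
    HEq (D'.comp (F'.map φ) (app b)) (D'.comp (app a) (G'.map φ))

namespace DispFunctor

section

variable {C : Type u₁} [Category.{v₁} C] {C' : Type u₂} [Category.{v₂} C']
  {C'' : Type u₃} [Category.{v₃} C''] {D : DispCat.{w₁', w₁} C} {D' : DispCat.{w₂', w₂} C'}
  {D'' : DispCat.{w₃', w₃} C''} {F : C ⥤ C'} {G : C' ⥤ C''}

theorem map_heq (F' : DispFunctor F D D') {x y : C} {f g : x ⟶ y} (h : f = g) {a : D.Obj x}
    {b : D.Obj y} {φ : D.Hom f a b} {ψ : D.Hom g a b} (hφ : HEq φ ψ) :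
    HEq (F'.map φ) (F'.map ψ) := by
  subst h; cases hφ; rfl

/-- The identity displayed functor. -/
def id (D : DispCat.{w₁', w₁} C) : DispFunctor (𝟭 C) D D where
  obj a := a
  map φ := φ
  map_id _ := HEq.rfl
  map_comp _ _ := HEq.rfl

/-- Composition of displayed functors. -/
def comp (F' : DispFunctor F D D') (G' : DispFunctor G D' D'') :
    DispFunctor (F ⋙ G) D D'' where
  obj a := G'.obj (F'.obj a)
  map φ := G'.map (F'.map φ)
  map_id a := (G'.map_heq (F.map_id _) (F'.map_id a)).trans (G'.map_id _)
  map_comp φ ψ := (G'.map_heq (F.map_comp _ _) (F'.map_comp φ ψ)).trans (G'.map_comp _ _)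

/-- The functor between fibers induced by a displayed functor. -/
def fiber (F' : DispFunctor F D D') (x : C) : D.Fiber x ⥤ D'.Fiber (F.obj x) where
  obj a := F'.obj a
  map φ := D'.tr (F.map_id x) (F'.map φ)
  map_id a := eq_of_heq ((D'.tr_heq _ _).trans (F'.map_id a))
  map_comp φ ψ := eq_of_heq ((D'.tr_heq _ _).trans
    ((F'.map_heq (Category.id_comp (𝟙 x)).symm (D.tr_heq _ _)).trans
      ((F'.map_comp φ ψ).trans
        ((D'.comp_heq (F.map_id x) (D'.tr_heq _ _).symm (F.map_id x) (D'.tr_heq _ _).symm).trans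
          (D'.tr_heq _ _).symm))))

/-- A displayed functor is Cartesian if it preserves Cartesian morphisms. -/
def IsCartesian (F' : DispFunctor F D D') : Prop :=
  ∀ ⦃x y : C⦄ ⦃f : x ⟶ y⦄ ⦃a : D.Obj x⦄ ⦃b : D.Obj y⦄ (φ : D.Hom f a b),
    D.IsCartesian φ → D'.IsCartesian (F'.map φ)

/-- A displayed functor is fully faithful if it is bijective on morphisms over each `f`. -/
def FullyFaithful (F' : DispFunctor F D D') : Prop :=
  ∀ ⦃x y : C⦄ (f : x ⟶ y) (a : D.Obj x) (b : D.Obj y),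
    Function.Bijective (fun φ : D.Hom f a b => F'.map φ)

end

end DispFunctor

/-! ### The displayed category of arrows -/

section Arrow

variable {C : Type u} [Category.{v} C]

/-- Objects over `y`: morphisms with codomain `y`. -/
structure ArrObj (y : C) where
  dom : C
  hom : dom ⟶ y

/-- Morphisms over `f`: commutative squares with bottom side `f`. -/
@[ext]
structure ArrHom {x y : C} (f : x ⟶ y) (a : ArrObj x) (b : ArrObj y) where
  left : a.dom ⟶ b.dom
  w : left ≫ b.hom = a.hom ≫ f

theorem ArrHom.heq {x y : C} {f g : x ⟶ y} (h : f = g) {a : ArrObj x} {b : ArrObj y}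
    {φ : ArrHom f a b} {ψ : ArrHom g a b} (hl : φ.left = ψ.left) : HEq φ ψ := by
  subst h; exact heq_of_eq (ArrHom.ext hl)

theorem ArrHom.left_eq {x y : C} {f g : x ⟶ y} (h : f = g) {a : ArrObj x} {b : ArrObj y}
    {φ : ArrHom f a b} {ψ : ArrHom g a b} (hl : HEq φ ψ) : φ.left = ψ.left := by
  subst h; cases hl; rfl

variable (C) in
/-- The displayed category of arrows over `C`. -/
def arr : DispCat.{v, max u v} C where
  Obj := ArrObj
  Hom := ArrHom
  id a := ⟨𝟙 a.dom, by simp⟩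
  comp φ ψ := ⟨φ.left ≫ ψ.left, by rw [Category.assoc, ψ.w, ← Category.assoc, φ.w, Category.assoc]⟩
  id_comp φ := ArrHom.heq (Category.id_comp _) (Category.id_comp _)
  comp_id φ := ArrHom.heq (Category.comp_id _) (Category.comp_id _)
  assoc φ ψ θ := ArrHom.heq (Category.assoc _ _ _) (Category.assoc _ _ _)

variable {C' : Type u₁} [Category.{v₁} C']

/-- The action of a functor on arrows. -/
def arrMap (F : C ⥤ C') : DispFunctor F (arr C) (arr C') where
  obj a := ⟨F.obj a.dom, F.map a.hom⟩
  map φ := ⟨F.map φ.left, by rw [← F.map_comp, φ.w, F.map_comp]⟩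
  map_id a := ArrHom.heq (F.map_id _) (F.map_id _)
  map_comp φ ψ := ArrHom.heq (F.map_comp _ _) (F.map_comp _ _)

/-- The action of a natural transformation on arrows. -/
def arrMap₂ {F G : C ⥤ C'} (τ : F ⟶ G) : DispNatTrans τ (arrMap F) (arrMap G) where
  app a := ⟨τ.app a.dom, (τ.naturality a.hom).symm⟩
  naturality φ := ArrHom.heq (τ.naturality _) (τ.naturality φ.left)

end Arrow

/-! ### Comprehension functors and pseudo morphisms -/

/-- A category, a displayed category over it, and a displayed functor over the identity to the
displayed category of arrows. -/
structure CompData : Type (max (u + 1) (v + 1)) where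
  C : Type u
  [cat : Category.{v} C]
  D : DispCat.{v, max u v} C
  χ : DispFunctor (𝟭 C) D (arr C)

attribute [instance] CompData.cat

namespace CompData

/-- Context extension `x.a`, the domain of `χ a`. -/
def ext (X : CompData.{v, u}) {x : X.C} (a : X.D.Obj x) : X.C :=
  (X.χ.obj a : ArrObj x).dom

/-- The projection `x.a ⟶ x`. -/
def π (X : CompData.{v, u}) {x : X.C} (a : X.D.Obj x) : X.ext a ⟶ x :=
  (X.χ.obj a : ArrObj x).hom

/-- The action of the comprehension functor on morphisms, between context extensions. -/
def extMap (X : CompData.{v, u}) {x y : X.C} {f : x ⟶ y} {a : X.D.Obj x} {b : X.D.Obj y}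
    (φ : X.D.Hom f a b) : X.ext a ⟶ X.ext b :=
  (X.χ.map φ : ArrHom f (X.χ.obj a) (X.χ.obj b)).left

/-- The identity of `F`, as a transformation `𝟭 ⋙ F ⟶ F ⋙ 𝟭`. -/
def _root_.CompLang.idSquare {C : Type u₁} [Category.{v₁} C] {C' : Type u₂} [Category.{v₂} C'] (F : C ⥤ C') :
    𝟭 C ⋙ F ⟶ F ⋙ 𝟭 C' where
  app x := 𝟙 (F.obj x)
  naturality x y f := by
    rw [Functor.comp_map, Functor.comp_map, Functor.id_map, Functor.id_map]
    exact (Category.comp_id _).trans (Category.id_comp _).symm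

/-- Pseudo morphisms: a functor, a displayed functor over it, and a displayed natural isomorphism
`χ ⋙ arr F ⟶ F' ⋙ χ` over the identity. A morphism of arrows over an identity is invertible if
and only if the morphism between the domains is. -/
structure Hom (X Y : CompData.{v, u}) where
  F : X.C ⥤ Y.C
  F' : DispFunctor F X.D Y.D
  chi : DispNatTrans (idSquare F) (X.χ.comp (arrMap F)) (F'.comp Y.χ)
  isIso_chi : ∀ {x : X.C} (a : X.D.Obj x), IsIso (chi.app a : ArrHom _ _ _).left

namespace Hom

variable {X Y : CompData.{v, u}} (f : Hom X Y)

/-- The components `F(x.a) ⟶ F(x).F'(a)` of the comparison. -/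
def comparison {x : X.C} (a : X.D.Obj x) : f.F.obj (X.ext a) ⟶ Y.ext (f.F'.obj a) :=
  (f.chi.app a : ArrHom _ _ _).left

instance {x : X.C} (a : X.D.Obj x) : IsIso (f.comparison a) := f.isIso_chi a

theorem comparison_natural {x y : X.C} {g : x ⟶ y} {a : X.D.Obj x} {b : X.D.Obj y}
    (φ : X.D.Hom g a b) :
    f.F.map (X.extMap φ) ≫ f.comparison b = f.comparison a ≫ Y.extMap (f.F'.map φ) :=
  ArrHom.left_eq ((idSquare f.F).naturality g) (f.chi.naturality φ)

theorem comparison_π {x : X.C} (a : X.D.Obj x) :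
    f.comparison a ≫ Y.π (f.F'.obj a) = f.F.map (X.π a) :=
  (f.chi.app a : ArrHom _ _ _).w.trans (Category.comp_id _)

end Hom

/-- The inverse of the comparison. -/
noncomputable def Hom.invComparison {X Y : CompData.{v, u}} (f : Hom X Y) {x : X.C}
    (a : X.D.Obj x) : Y.ext (f.F'.obj a) ⟶ f.F.obj (X.ext a) :=
  inv (f.comparison a)

namespace Hom

variable {X Y : CompData.{v, u}} (f : Hom X Y)

theorem comparison_inv {x : X.C} (a : X.D.Obj x) :
    f.comparison a ≫ f.invComparison a = 𝟙 _ :=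
  IsIso.hom_inv_id _

theorem inv_comparison {x : X.C} (a : X.D.Obj x) :
    f.invComparison a ≫ f.comparison a = 𝟙 _ :=
  IsIso.inv_hom_id _

theorem invComparison_natural {x y : X.C} {g : x ⟶ y} {a : X.D.Obj x} {b : X.D.Obj y}
    (φ : X.D.Hom g a b) :
    Y.extMap (f.F'.map φ) ≫ f.invComparison b = f.invComparison a ≫ f.F.map (X.extMap φ) := by
  unfold invComparison
  rw [IsIso.comp_inv_eq, Category.assoc, f.comparison_natural, IsIso.inv_hom_id_assoc]

theorem invComparison_π {x : X.C} (a : X.D.Obj x) :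
    f.invComparison a ≫ f.F.map (X.π a) = Y.π (f.F'.obj a) := by
  unfold invComparison
  rw [IsIso.inv_comp_eq, f.comparison_π]

end Hom

/-- 2-cells: a natural transformation and a displayed natural transformation over it, compatible
with the comparisons. -/
structure Hom₂ {X Y : CompData.{v, u}} (f g : Hom X Y) where
  nat : f.F ⟶ g.F
  nat' : DispNatTrans nat f.F' g.F'
  compat : ∀ {x : X.C} (a : X.D.Obj x),
    f.comparison a ≫ Y.extMap (nat'.app a) = nat.app (X.ext a) ≫ g.comparison a

theorem Hom₂.ext_heq {X Y : CompData.{v, u}} {f g : Hom X Y} {σ τ : Hom₂ f g}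
    (h : ∀ x, σ.nat.app x = τ.nat.app x)
    (h' : ∀ {x : X.C} (a : X.D.Obj x), HEq (σ.nat'.app a) (τ.nat'.app a)) : σ = τ := by
  obtain ⟨s, ⟨s', _⟩, _⟩ := σ
  obtain ⟨t, ⟨t', _⟩, _⟩ := τ
  obtain rfl : s = t := NatTrans.ext (funext h)
  obtain rfl : @s' = @t' := by
    funext x a
    exact eq_of_heq (h' a)
  rfl

theorem extMap_heq (X : CompData.{v, u}) {x y : X.C} {f g : x ⟶ y} (h : f = g) {a : X.D.Obj x}
    {b : X.D.Obj y} {φ : X.D.Hom f a b} {ψ : X.D.Hom g a b} (hφ : HEq φ ψ) :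
    X.extMap φ = X.extMap ψ := by
  subst h; cases hφ; rfl

theorem extMap_id (X : CompData.{v, u}) {x : X.C} (a : X.D.Obj x) :
    X.extMap (X.D.id a) = 𝟙 (X.ext a) :=
  ArrHom.left_eq rfl (X.χ.map_id a)

theorem extMap_comp (X : CompData.{v, u}) {x y z : X.C} {f : x ⟶ y} {g : y ⟶ z} {a : X.D.Obj x}
    {b : X.D.Obj y} {c : X.D.Obj z} (φ : X.D.Hom f a b) (ψ : X.D.Hom g b c) :
    X.extMap (X.D.comp φ ψ) = X.extMap φ ≫ X.extMap ψ :=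
  ArrHom.left_eq rfl (X.χ.map_comp φ ψ)

theorem extMap_π (X : CompData.{v, u}) {x y : X.C} {f : x ⟶ y} {a : X.D.Obj x}
    {b : X.D.Obj y} (φ : X.D.Hom f a b) : X.extMap φ ≫ X.π b = X.π a ≫ f :=
  (X.χ.map φ : ArrHom _ _ _).w

/-- The identity pseudo morphism. -/
def Hom.id (X : CompData.{v, u}) : Hom X X where
  F := 𝟭 X.C
  F' := DispFunctor.id X.D
  chi :=
    { app := fun a => (arr X.C).id (X.χ.obj a)
      naturality := fun _ => (DispCat.comp_id _ _).trans (DispCat.id_comp _ _).symm }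
  isIso_chi a := (inferInstance : IsIso (𝟙 (X.ext a)))

/-- Composition of pseudo morphisms. -/
def Hom.comp {X Y Z : CompData.{v, u}} (f : Hom X Y) (g : Hom Y Z) : Hom X Z where
  F := f.F ⋙ g.F
  F' := f.F'.comp g.F'
  chi :=
    { app := fun {x} a => (⟨g.F.map (f.comparison a) ≫ g.comparison (f.F'.obj a), by
        change (_ ≫ _) ≫ Z.π _ = g.F.map (f.F.map (X.π a)) ≫ 𝟙 _
        rw [Category.assoc, g.comparison_π, ← g.F.map_comp, f.comparison_π, Category.comp_id]⟩ :
          ArrHom (𝟙 (g.F.obj (f.F.obj x))) _ _)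
      naturality := fun {_ _ h a b} φ => by
        refine ArrHom.heq ((idSquare (f.F ⋙ g.F)).naturality h) ?_
        change g.F.map (f.F.map (X.extMap φ)) ≫ g.F.map (f.comparison b) ≫ g.comparison _ =
          (g.F.map (f.comparison a) ≫ g.comparison _) ≫ Z.extMap (g.F'.map (f.F'.map φ))
        rw [← Category.assoc, ← g.F.map_comp, f.comparison_natural, g.F.map_comp, Category.assoc,
          g.comparison_natural, Category.assoc] }
  isIso_chi a := (inferInstance : IsIso (g.F.map (f.comparison a) ≫ g.comparison (f.F'.obj a)))

theorem Hom.invComparison_comp {X Y Z : CompData.{v, u}} (f : Hom X Y) (g : Hom Y Z) {x : X.C}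
    (a : X.D.Obj x) : (f.comp g).invComparison a =
      g.invComparison (f.F'.obj a) ≫ g.F.map (f.invComparison a) := by
  change inv (g.F.map (f.comparison a) ≫ g.comparison (f.F'.obj a)) = _
  rw [IsIso.inv_comp, ← Functor.map_inv]; rfl

theorem Hom.invComparison_coherence {X Y Z : CompData.{v, u}} (f : Hom X Y) (g : Hom Y Z)
    {x : X.C} (a : X.D.Obj x) :
    (f.comp g).invComparison a ≫
        𝟙 (g.F.obj (f.F.obj (X.ext a))) ≫ 𝟙 (g.F.obj (f.F.obj (X.ext a))) =
      Z.extMap (Z.D.id (g.F'.obj (f.F'.obj a))) ≫ 𝟙 (Z.ext (g.F'.obj (f.F'.obj a))) ≫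
        g.invComparison (f.F'.obj a) ≫ 𝟙 (g.F.obj (Y.ext (f.F'.obj a))) ≫
          g.F.map (f.invComparison a) ≫ 𝟙 (g.F.obj (f.F.obj (X.ext a))) := by
  rw [f.invComparison_comp g, extMap_id]
  simp only [Category.id_comp]
  erw [Category.comp_id, Category.comp_id, Category.comp_id]

/-- Pairs of a natural and a displayed natural transformation between 1-cells, as 2-cells. -/
instance homCategory (X Y : CompData.{v, u}) : Category (Hom X Y) where
  Hom f g := Hom₂ f g
  id f :=
    { nat := 𝟙 f.F
      nat' :=
        { app := fun a => Y.D.id (f.F'.obj a)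
          naturality := fun _ => (Y.D.comp_id _).trans (Y.D.id_comp _).symm }
      compat := fun a => by
        change _ ≫ Y.extMap (Y.D.id _) = 𝟙 _ ≫ _
        rw [extMap_id, Category.comp_id, Category.id_comp] }
  comp {f g h} σ τ :=
    { nat := σ.nat ≫ τ.nat
      nat' :=
        { app := fun a => Y.D.comp (σ.nat'.app a) (τ.nat'.app a)
          naturality := fun {x y k a b} φ => by
            refine (Y.D.assoc _ _ _).symm.trans ?_
            refine (Y.D.comp_heq (σ.nat.naturality k) (σ.nat'.naturality φ) rfl HEq.rfl).trans ?_
            refine (Y.D.assoc _ _ _).trans ?_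
            refine HEq.trans ?_ (Y.D.assoc _ _ _).symm
            exact Y.D.comp_heq rfl HEq.rfl (τ.nat.naturality k) (τ.nat'.naturality φ) }
      compat := fun {x} a => by
        change _ ≫ Y.extMap (Y.D.comp _ _) = (σ.nat.app _ ≫ τ.nat.app _) ≫ _
        rw [extMap_comp, ← Category.assoc, σ.compat, Category.assoc, τ.compat, Category.assoc] }
  id_comp σ := Hom₂.ext_heq (fun _ => Category.id_comp _) (fun _ => Y.D.id_comp _)
  comp_id σ := Hom₂.ext_heq (fun _ => Category.comp_id _) (fun _ => Y.D.comp_id _)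
  assoc σ τ ρ := Hom₂.ext_heq (fun _ => Category.assoc _ _ _) (fun _ => Y.D.assoc _ _ _)

/-- Invertible 2-cells from componentwise inverse 2-cells. -/
def isoOfId {X Y : CompData.{v, u}} {f g : Hom X Y} (σ : Hom₂ f g) (τ : Hom₂ g f)
    (h : ∀ x, σ.nat.app x ≫ τ.nat.app x = 𝟙 _) (h' : ∀ x, τ.nat.app x ≫ σ.nat.app x = 𝟙 _)
    (k : ∀ {x : X.C} (a : X.D.Obj x),
      HEq (Y.D.comp (σ.nat'.app a) (τ.nat'.app a)) (Y.D.id (f.F'.obj a)))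
    (k' : ∀ {x : X.C} (a : X.D.Obj x),
      HEq (Y.D.comp (τ.nat'.app a) (σ.nat'.app a)) (Y.D.id (g.F'.obj a))) : f ≅ g where
  hom := σ
  inv := τ
  hom_inv_id := Hom₂.ext_heq h k
  inv_hom_id := Hom₂.ext_heq h' k'

/-- Left whiskering. -/
def whiskerL {X Y Z : CompData.{v, u}} (f : Hom X Y) {g h : Hom Y Z} (σ : g ⟶ h) :
    f.comp g ⟶ f.comp h :=
  show Hom₂ _ _ from
  { nat := Functor.whiskerLeft f.F σ.nat
    nat' :=
      { app := fun a => σ.nat'.app (f.F'.obj a)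
        naturality := fun φ => σ.nat'.naturality (f.F'.map φ) }
    compat := fun {x} a => by
      change (g.F.map (f.comparison a) ≫ g.comparison _) ≫ Z.extMap (σ.nat'.app _) =
        σ.nat.app _ ≫ h.F.map (f.comparison a) ≫ h.comparison _
      rw [Category.assoc, σ.compat, ← Category.assoc, ← Category.assoc, σ.nat.naturality] }

/-- Right whiskering. -/
def whiskerR {X Y Z : CompData.{v, u}} {f g : Hom X Y} (σ : f ⟶ g) (h : Hom Y Z) :
    f.comp h ⟶ g.comp h :=
  show Hom₂ _ _ from
  { nat := Functor.whiskerRight σ.nat h.F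
    nat' :=
      { app := fun a => h.F'.map (σ.nat'.app a)
        naturality := fun {x y k a b} φ =>
          (h.F'.map_comp _ _).symm.trans
            ((h.F'.map_heq (σ.nat.naturality k) (σ.nat'.naturality φ)).trans
              (h.F'.map_comp _ _)) }
    compat := fun {x} a => by
      change (h.F.map (f.comparison a) ≫ h.comparison _) ≫ Z.extMap (h.F'.map (σ.nat'.app a)) =
        h.F.map (σ.nat.app _) ≫ h.F.map (g.comparison a) ≫ h.comparison _
      rw [Category.assoc, ← h.comparison_natural, ← Category.assoc, ← Category.assoc,
        ← h.F.map_comp, ← h.F.map_comp, σ.compat] }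

/-- The associator. -/
def assocIso {X Y Z W : CompData.{v, u}} (f : Hom X Y) (g : Hom Y Z) (h : Hom Z W) :
    (f.comp g).comp h ≅ f.comp (g.comp h) :=
  isoOfId
    { nat := (Functor.associator f.F g.F h.F).hom
      nat' :=
        { app := fun a => W.D.id _
          naturality := fun _ => (W.D.comp_id _).trans (W.D.id_comp _).symm }
      compat := fun a => by
        change (h.F.map (g.F.map (f.comparison a) ≫ g.comparison _) ≫ h.comparison _) ≫
          W.extMap (W.D.id _) = 𝟙 _ ≫ h.F.map (g.F.map (f.comparison a)) ≫
            h.F.map (g.comparison _) ≫ h.comparison _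
        rw [extMap_id, Category.comp_id, Category.id_comp, h.F.map_comp, Category.assoc] }
    { nat := (Functor.associator f.F g.F h.F).inv
      nat' :=
        { app := fun a => W.D.id _
          naturality := fun _ => (W.D.comp_id _).trans (W.D.id_comp _).symm }
      compat := fun a => by
        change (h.F.map (g.F.map (f.comparison a)) ≫
            h.F.map (g.comparison _) ≫ h.comparison _) ≫ W.extMap (W.D.id _) =
            𝟙 _ ≫ h.F.map (g.F.map (f.comparison a) ≫ g.comparison _) ≫ h.comparison _
        rw [extMap_id, Category.comp_id, Category.id_comp, h.F.map_comp, Category.assoc] }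
    (fun _ => Category.id_comp _) (fun _ => Category.id_comp _)
    (fun _ => W.D.id_comp _) (fun _ => W.D.id_comp _)

/-- The left unitor. -/
def leftUnitIso {X Y : CompData.{v, u}} (f : Hom X Y) : (Hom.id X).comp f ≅ f :=
  isoOfId
    { nat := f.F.leftUnitor.hom
      nat' :=
        { app := fun a => Y.D.id _
          naturality := fun _ => (Y.D.comp_id _).trans (Y.D.id_comp _).symm }
      compat := fun a => by
        change (f.F.map (𝟙 _) ≫ f.comparison a) ≫ Y.extMap (Y.D.id _) = 𝟙 _ ≫ f.comparison a
        rw [extMap_id, Category.comp_id, f.F.map_id] }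
    { nat := f.F.leftUnitor.inv
      nat' :=
        { app := fun a => Y.D.id _
          naturality := fun _ => (Y.D.comp_id _).trans (Y.D.id_comp _).symm }
      compat := fun a => by
        change f.comparison a ≫ Y.extMap (Y.D.id _) = 𝟙 _ ≫ f.F.map (𝟙 _) ≫ f.comparison a
        rw [extMap_id, Category.comp_id, f.F.map_id, Category.id_comp, Category.id_comp] }
    (fun _ => Category.id_comp _) (fun _ => Category.id_comp _)
    (fun _ => Y.D.id_comp _) (fun _ => Y.D.id_comp _)

/-- The right unitor. -/
def rightUnitIso {X Y : CompData.{v, u}} (f : Hom X Y) : f.comp (Hom.id Y) ≅ f :=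
  isoOfId
    { nat := f.F.rightUnitor.hom
      nat' :=
        { app := fun a => Y.D.id _
          naturality := fun _ => (Y.D.comp_id _).trans (Y.D.id_comp _).symm }
      compat := fun a => by
        change (f.comparison a ≫ 𝟙 _) ≫ Y.extMap (Y.D.id _) = 𝟙 _ ≫ f.comparison a
        rw [extMap_id, Category.comp_id, Category.id_comp]
        exact Category.comp_id _ }
    { nat := f.F.rightUnitor.inv
      nat' :=
        { app := fun a => Y.D.id _
          naturality := fun _ => (Y.D.comp_id _).trans (Y.D.id_comp _).symm }
      compat := fun a => by
        change f.comparison a ≫ Y.extMap (Y.D.id _) = 𝟙 _ ≫ f.comparison a ≫ 𝟙 _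
        rw [extMap_id, Category.comp_id, Category.id_comp] }
    (fun _ => Category.id_comp _) (fun _ => Category.id_comp _)
    (fun _ => Y.D.id_comp _) (fun _ => Y.D.id_comp _)

/-- The bicategory of comprehension functors and pseudo morphisms. -/
instance bicategory : Bicategory CompData.{v, u} where
  Hom := Hom
  id := Hom.id
  comp := Hom.comp
  homCategory := homCategory
  whiskerLeft := whiskerL
  whiskerRight := whiskerR
  associator := assocIso
  leftUnitor := leftUnitIso
  rightUnitor := rightUnitIso
  whiskerLeft_id f g := Hom₂.ext_heq (fun _ => rfl) (fun _ => HEq.rfl)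
  whiskerLeft_comp _ _ _ _ _ _ := Hom₂.ext_heq (fun _ => rfl) (fun _ => HEq.rfl)
  id_whiskerLeft {X Y f g} σ := Hom₂.ext_heq
    (fun _ => ((Category.id_comp _).trans (Category.comp_id _)).symm)
    (fun _ => ((Y.D.id_comp _).trans (Y.D.comp_id _)).symm)
  comp_whiskerLeft {X Y Z W} f g {h h'} σ := Hom₂.ext_heq
    (fun _ => ((Category.id_comp _).trans (Category.comp_id _)).symm)
    (fun _ => ((W.D.id_comp _).trans (W.D.comp_id _)).symm)
  id_whiskerRight f g := Hom₂.ext_heq (fun _ => g.F.map_id _) (fun _ => g.F'.map_id _)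
  comp_whiskerRight σ τ g := Hom₂.ext_heq (fun _ => g.F.map_comp _ _) (fun _ => g.F'.map_comp _ _)
  whiskerRight_id {X Y f g} σ := Hom₂.ext_heq
    (fun _ => ((Category.id_comp _).trans (Category.comp_id _)).symm)
    (fun _ => ((Y.D.id_comp _).trans (Y.D.comp_id _)).symm)
  whiskerRight_comp {X Y Z W f f'} σ g h := Hom₂.ext_heq
    (fun _ => ((Category.id_comp _).trans (Category.comp_id _)).symm)
    (fun _ => ((W.D.id_comp _).trans (W.D.comp_id _)).symm)
  whisker_assoc {X Y Z W} f {g g'} σ h := Hom₂.ext_heq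
    (fun _ => ((Category.id_comp _).trans (Category.comp_id _)).symm)
    (fun _ => ((W.D.id_comp _).trans (W.D.comp_id _)).symm)
  whisker_exchange {X Y Z f g h i} σ τ := Hom₂.ext_heq
    (fun _ => (τ.nat.naturality _).symm)
    (fun _ => (τ.nat'.naturality _).symm)
  pentagon {X Y Z W V} f g h i := Hom₂.ext_heq
    (fun _ => by
      change i.F.map (𝟙 _) ≫ 𝟙 _ ≫ 𝟙 _ = 𝟙 _ ≫ 𝟙 _
      rw [i.F.map_id]; exact Category.id_comp _)
    (fun _ => (V.D.comp_heq (i.F.map_id _) (i.F'.map_id _) rfl HEq.rfl).trans (V.D.id_comp _))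
  triangle {X Y Z} f g := Hom₂.ext_heq
    (fun _ => (Category.id_comp _).trans (g.F.map_id _).symm)
    (fun _ => (Z.D.id_comp _).trans (g.F'.map_id _).symm)

end CompData

/-! ### The pseudofunctors and the pseudotransformation on comprehension functors -/

/-- The comprehension functor `𝟭 : arr C ⟶ arr C`. -/
abbrev arrObj (C : Type u) [Category.{v} C] : CompData.{v, u} where
  C := C
  D := arr C
  χ := DispFunctor.id (arr C)

/-- Equality of 2-cells with values in a displayed category of arrows. -/
theorem CompData.Hom₂.ext_arr {X : CompData.{v, u}} {C : Type u} [Category.{v} C]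
    {f g : CompData.Hom X (arrObj C)} {σ τ : CompData.Hom₂ f g}
    (h : ∀ x, σ.nat.app x = τ.nat.app x)
    (h' : ∀ {x : X.C} (a : X.D.Obj x),
      (σ.nat'.app a : ArrHom _ _ _).left = (τ.nat'.app a : ArrHom _ _ _).left) : σ = τ :=
  CompData.Hom₂.ext_heq h (fun {x} a => ArrHom.heq (h x) (h' a))

section

variable {C C' C'' : Type u} [Category.{v} C] [Category.{v} C'] [Category.{v} C'']

/-- The pseudo morphism `(F, arr F, 𝟙)`. -/
def arrHom (F : C ⥤ C') : CompData.Hom (arrObj C) (arrObj C') where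
  F := F
  F' := arrMap F
  chi :=
    { app := fun {x} a => (⟨𝟙 (F.obj (ArrObj.dom a)), by
        exact (Category.id_comp _).trans (Category.comp_id _).symm⟩ : ArrHom (𝟙 (F.obj x)) _ _)
      naturality := fun {_ _ k _ _} _ => ArrHom.heq ((idSquare F).naturality k)
        ((Category.comp_id _).trans (Category.id_comp _).symm) }
  isIso_chi a := (inferInstance : IsIso (𝟙 (F.obj (ArrObj.dom a))))

/-- The 2-cell `(τ, arr τ)`. -/
def arrHom₂ {F G : C ⥤ C'} (τ : F ⟶ G) : CompData.Hom₂ (arrHom F) (arrHom G) where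
  nat := τ
  nat' := arrMap₂ τ
  compat _ := (Category.id_comp _).trans (Category.comp_id _).symm

variable (C) in
/-- `arrHom` preserves identities. -/
def arrHomId : arrHom (𝟭 C) ≅ CompData.Hom.id (arrObj C) :=
  CompData.isoOfId
    { nat := 𝟙 (𝟭 C)
      nat' :=
        { app := fun a => (arr C).id a
          naturality := fun _ => ((arr C).comp_id _).trans ((arr C).id_comp _).symm }
      compat := fun _ => rfl }
    { nat := 𝟙 (𝟭 C)
      nat' :=
        { app := fun a => (arr C).id a
          naturality := fun _ => ((arr C).comp_id _).trans ((arr C).id_comp _).symm }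
      compat := fun _ => rfl }
    (fun _ => Category.id_comp _) (fun _ => Category.id_comp _)
    (fun _ => (arr C).id_comp _) (fun _ => (arr C).id_comp _)

theorem arrHom_comparison_comp (F : C ⥤ C') (G : C' ⥤ C'') {x : C} (a : ArrObj x) :
    ((arrHom F).comp (arrHom G)).comparison a = 𝟙 (G.obj (F.obj a.dom)) := by
  change G.map (𝟙 (F.obj a.dom)) ≫ 𝟙 (G.obj (F.obj a.dom)) = _
  rw [G.map_id, Category.id_comp]

/-- `arrHom` preserves composition. -/
def arrHomComp (F : C ⥤ C') (G : C' ⥤ C'') : arrHom (F ⋙ G) ≅ (arrHom F).comp (arrHom G) :=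
  CompData.isoOfId
    { nat := 𝟙 (F ⋙ G)
      nat' :=
        { app := fun a => (arr C'').id ((arrMap (F ⋙ G)).obj a)
          naturality := fun _ => ((arr C'').comp_id _).trans ((arr C'').id_comp _).symm }
      compat := fun {_} (a : ArrObj _) =>
        congrArg (𝟙 (G.obj (F.obj a.dom)) ≫ ·) (arrHom_comparison_comp F G a).symm }
    { nat := 𝟙 (F ⋙ G)
      nat' :=
        { app := fun a => (arr C'').id ((arrMap (F ⋙ G)).obj a)
          naturality := fun _ => ((arr C'').comp_id _).trans ((arr C'').id_comp _).symm }
      compat := fun {_} (a : ArrObj _) =>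
        congrArg (· ≫ 𝟙 (G.obj (F.obj a.dom))) (arrHom_comparison_comp F G a) }
    (fun _ => Category.id_comp _) (fun _ => Category.id_comp _)
    (fun _ => (arr C'').id_comp _) (fun _ => (arr C'').id_comp _)

end

/-- The pseudofunctor that sends `C` to `𝟭 : arr C ⟶ arr C`. -/
def arrPseudo : Pseudofunctor Cat.{v, u} CompData.{v, u} where
  obj C := arrObj C
  map F := arrHom F.toFunctor
  map₂ τ := arrHom₂ τ.toNatTrans
  map₂_id _ := CompData.Hom₂.ext_arr (fun _ => rfl) (fun _ => rfl)
  map₂_comp _ _ := CompData.Hom₂.ext_arr (fun _ => rfl) (fun _ => rfl)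
  mapId C := arrHomId C
  mapComp F G := arrHomComp F.toFunctor G.toFunctor
  map₂_whisker_left F _ _ τ := by
    apply CompData.Hom₂.ext_arr
    · intro x
      exact ((Category.id_comp _).trans (Category.comp_id _)).symm
    · intro x a
      exact ((Category.id_comp _).trans (Category.comp_id _)).symm
  map₂_whisker_right τ H := by
    apply CompData.Hom₂.ext_arr
    · intro x
      exact ((Category.id_comp _).trans (Category.comp_id _)).symm
    · intro x a
      exact ((Category.id_comp _).trans (Category.comp_id _)).symm
  map₂_associator {X Y Z W} F G H := by
    have key : ∀ y : X, 𝟙 (H.toFunctor.obj (G.toFunctor.obj (F.toFunctor.obj y))) =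
        𝟙 _ ≫ H.toFunctor.map (𝟙 _) ≫ 𝟙 _ ≫ 𝟙 _ ≫ 𝟙 _ := by simp
    apply CompData.Hom₂.ext_arr
    · intro x
      exact key x
    · intro x a
      exact key (ArrObj.dom a)
  map₂_left_unitor {X Y} F := by
    have key : ∀ y : X, 𝟙 (F.toFunctor.obj y) = 𝟙 _ ≫ F.toFunctor.map (𝟙 y) ≫ 𝟙 _ := by simp
    apply CompData.Hom₂.ext_arr
    · intro x
      exact key x
    · intro x a
      exact key (ArrObj.dom a)
  map₂_right_unitor {X Y} F := by
    have key : ∀ y : X, 𝟙 (F.toFunctor.obj y) = 𝟙 _ ≫ 𝟙 _ ≫ 𝟙 _ := by simp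
    apply CompData.Hom₂.ext_arr
    · intro x
      exact key x
    · intro x a
      exact key (ArrObj.dom a)

/-- The pseudofunctor that sends a comprehension functor to its category of contexts. -/
def basePseudo : Pseudofunctor CompData.{v, u} Cat.{v, u} where
  obj X := Cat.of X.C
  map f := f.F.toCatHom
  map₂ σ := σ.nat.toCatHom₂
  map₂_id _ := rfl
  map₂_comp _ _ := rfl
  mapId X := Cat.Hom.isoMk (Iso.refl (𝟭 X.C))
  mapComp f g := Cat.Hom.isoMk (Iso.refl (f.F ⋙ g.F))
  map₂_whisker_left f _ _ σ := by
    ext x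
    exact ((Category.id_comp _).trans (Category.comp_id _)).symm
  map₂_whisker_right σ h := by
    ext x
    exact ((Category.id_comp _).trans (Category.comp_id _)).symm
  map₂_associator {X Y Z W} f g h := by
    have key : ∀ y : X.C, 𝟙 (h.F.obj (g.F.obj (f.F.obj y))) =
        𝟙 _ ≫ h.F.map (𝟙 _) ≫ 𝟙 _ ≫ 𝟙 _ ≫ 𝟙 _ := by simp
    ext x
    exact key x
  map₂_left_unitor {X Y} f := by
    have key : ∀ y : X.C, 𝟙 (f.F.obj y) = 𝟙 _ ≫ f.F.map (𝟙 y) ≫ 𝟙 _ := by simp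
    ext x
    exact key x
  map₂_right_unitor {X Y} f := by
    have key : ∀ y : X.C, 𝟙 (f.F.obj y) = 𝟙 _ ≫ 𝟙 _ ≫ 𝟙 _ := by simp
    ext x
    exact key x

/-- The pseudo morphism `(𝟭, χ)` from `X` to `𝟭 : arr X.C ⟶ arr X.C`. -/
def counitApp (X : CompData.{v, u}) : CompData.Hom X (arrObj X.C) where
  F := 𝟭 X.C
  F' := X.χ
  chi :=
    { app := fun {x} a => (⟨𝟙 (X.ext a), (Category.id_comp _).trans (Category.comp_id _).symm⟩ :
        ArrHom (𝟙 x) _ _)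
      naturality := fun {_ _ k _ _} _ => ArrHom.heq ((idSquare (𝟭 X.C)).naturality k)
        ((Category.comp_id _).trans (Category.id_comp _).symm) }
  isIso_chi a := (inferInstance : IsIso (𝟙 (X.ext a)))

/-- The naturality square of the pseudotransformation, given by the identity and the comparison
of the pseudo morphism. -/
noncomputable def counitNat {X Y : CompData.{v, u}} (f : CompData.Hom X Y) :
    f.comp (counitApp Y) ≅ (counitApp X).comp (arrHom f.F) :=
  CompData.isoOfId
    { nat := 𝟙 f.F
      nat' :=
        { app := fun {x} a => (⟨f.invComparison a,
            (f.invComparison_π a).trans (Category.comp_id _).symm⟩ : ArrHom (𝟙 (f.F.obj x)) _ _)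
          naturality := fun {_ _ k _ _} φ => by
            exact ArrHom.heq ((𝟙 f.F : f.F ⟶ f.F).naturality k) (f.invComparison_natural φ) }
      compat := fun {x} a => by
        have h : (f.comparison a ≫ 𝟙 _) ≫ f.invComparison a =
            𝟙 _ ≫ f.F.map (𝟙 (X.ext a)) ≫ 𝟙 _ := by
          rw [Category.comp_id, f.comparison_inv]; simp
        exact h }
    { nat := 𝟙 f.F
      nat' :=
        { app := fun {x} a => (⟨f.comparison a,
            (f.comparison_π a).trans (Category.comp_id _).symm⟩ : ArrHom (𝟙 (f.F.obj x)) _ _)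
          naturality := fun {_ _ k _ _} φ => by
            exact ArrHom.heq ((𝟙 f.F : f.F ⟶ f.F).naturality k) (f.comparison_natural φ) }
      compat := fun {x} a => by
        have h : (f.F.map (𝟙 (X.ext a)) ≫ 𝟙 _) ≫ f.comparison a =
            𝟙 _ ≫ f.comparison a ≫ 𝟙 _ := by simp
        exact h }
    (fun _ => Category.id_comp _) (fun _ => Category.id_comp _)
    (fun a => ArrHom.heq (Category.id_comp _) (f.inv_comparison a))
    (fun a => ArrHom.heq (Category.id_comp _) (f.comparison_inv a))

/-- The pseudotransformation from the identity to `basePseudo ⋙ arrPseudo` given by `(𝟭, χ)`. -/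
noncomputable def counitData : Pseudofunctor.StrongTrans (Pseudofunctor.id CompData.{v, u})
    (basePseudo.comp arrPseudo) where
  app X := counitApp X
  naturality f := counitNat f
  naturality_naturality {X Y f g} σ := by
    apply CompData.Hom₂.ext_arr
    · intro x
      exact (Category.comp_id _).trans (Category.id_comp _).symm
    · intro x a
      change Y.extMap (σ.nat'.app a) ≫ CompData.Hom.invComparison g a =
        CompData.Hom.invComparison f a ≫ σ.nat.app (X.ext a)
      have h := σ.compat a
      unfold CompData.Hom.invComparison
      rw [IsIso.comp_inv_eq, Category.assoc, ← h, IsIso.inv_hom_id_assoc]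
  naturality_id X := by
    apply CompData.Hom₂.ext_arr
    · intro x
      have key : ∀ y : X.C, 𝟙 y ≫ 𝟙 y ≫ 𝟙 y = 𝟙 y ≫ 𝟙 y ≫ 𝟙 y := fun _ => rfl
      exact key x
    · intro x a
      have h : CompData.Hom.invComparison (CompData.Hom.id X) a = 𝟙 (X.ext a) :=
        IsIso.inv_id
      have h' : X.extMap (X.D.id a) = 𝟙 (X.ext a) := X.extMap_id a
      have key : CompData.Hom.invComparison (CompData.Hom.id X) a ≫ 𝟙 (X.ext a) ≫ 𝟙 (X.ext a) =
          X.extMap (X.D.id a) ≫ 𝟙 (X.ext a) ≫ 𝟙 (X.ext a) := by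
        rw [h, h']; rfl
      exact key
  naturality_comp {X Y Z} f g := by
    apply CompData.Hom₂.ext_arr
    · intro x
      have key : ∀ y : X.C, 𝟙 (g.F.obj (f.F.obj y)) ≫ 𝟙 _ ≫ 𝟙 _ =
          𝟙 _ ≫ 𝟙 _ ≫ 𝟙 _ ≫ 𝟙 _ ≫ g.F.map (𝟙 (f.F.obj y)) ≫ 𝟙 _ := by simp
      exact key x
    · intro x a
      exact CompData.Hom.invComparison_coherence f g a

/-! ### Subbicategories -/

section Subbicategory

open Bicategory

/-- A subbicategory of `B` on the objects satisfying `P` and the 1-cells satisfying `Q`, with all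
2-cells between them. -/
structure SubbicatData (B : Type u₁) [Bicategory.{w₁, v₁} B] where
  P : B → Prop
  Q : ∀ {x y : B}, (x ⟶ y) → Prop
  id : ∀ x : B, Q (𝟙 x)
  comp : ∀ {x y z : B} (f : x ⟶ y) (g : y ⟶ z), Q f → Q g → Q (f ≫ g)

namespace SubbicatData

variable {B : Type u₁} [Bicategory.{w₁, v₁} B] (S : SubbicatData B)

/-- Objects of the subbicategory. -/
structure Obj where
  obj : B
  prop : S.P obj

/-- 1-cells of the subbicategory. -/
structure Hom (x y : S.Obj) where
  hom : x.obj ⟶ y.obj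
  prop : S.Q hom

instance homCategory (x y : S.Obj) : Category (S.Hom x y) where
  Hom f g := f.hom ⟶ g.hom
  id f := 𝟙 f.hom
  comp σ τ := σ ≫ τ
  id_comp _ := Category.id_comp _
  comp_id _ := Category.comp_id _
  assoc _ _ _ := Category.assoc _ _ _

variable {S} in
/-- Invertible 2-cells of the subbicategory. -/
def isoMk {x y : S.Obj} {f g : S.Hom x y} (e : f.hom ≅ g.hom) : f ≅ g where
  hom := e.hom
  inv := e.inv
  hom_inv_id := e.hom_inv_id
  inv_hom_id := e.inv_hom_id

instance bicategory : Bicategory S.Obj where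
  Hom := S.Hom
  id x := ⟨𝟙 x.obj, S.id _⟩
  comp f g := ⟨f.hom ≫ g.hom, S.comp _ _ f.prop g.prop⟩
  homCategory := S.homCategory
  whiskerLeft f _ _ σ := f.hom ◁ σ
  whiskerRight σ h := Bicategory.whiskerRight σ h.hom
  associator f g h := isoMk (α_ f.hom g.hom h.hom)
  leftUnitor f := isoMk (λ_ f.hom)
  rightUnitor f := isoMk (ρ_ f.hom)
  whiskerLeft_id f g := Bicategory.whiskerLeft_id f.hom g.hom
  whiskerLeft_comp f _ _ _ σ τ := Bicategory.whiskerLeft_comp f.hom σ τ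
  id_whiskerLeft σ := Bicategory.id_whiskerLeft σ
  comp_whiskerLeft f g _ _ σ := Bicategory.comp_whiskerLeft f.hom g.hom σ
  id_whiskerRight f g := Bicategory.id_whiskerRight f.hom g.hom
  comp_whiskerRight σ τ g := Bicategory.comp_whiskerRight σ τ g.hom
  whiskerRight_id σ := Bicategory.whiskerRight_id σ
  whiskerRight_comp σ g h := Bicategory.whiskerRight_comp σ g.hom h.hom
  whisker_assoc f _ _ σ h := Bicategory.whisker_assoc f.hom σ h.hom
  whisker_exchange σ τ := Bicategory.whisker_exchange σ τ
  pentagon f g h i := Bicategory.pentagon f.hom g.hom h.hom i.hom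
  triangle f g := Bicategory.triangle f.hom g.hom

variable {B' : Type u₂} [Bicategory.{w₂, v₂} B'] {S} {S' : SubbicatData B'}

/-- Restriction of a pseudofunctor to subbicategories. -/
def lift (F : Pseudofunctor B B') (hP : ∀ x, S.P x → S'.P (F.obj x))
    (hQ : ∀ {x y : B} (f : x ⟶ y), S.P x → S.P y → S.Q f → S'.Q (F.map f)) :
    Pseudofunctor S.Obj S'.Obj where
  obj x := ⟨F.obj x.obj, hP _ x.prop⟩
  map {x y} f := ⟨F.map f.hom, hQ _ x.prop y.prop f.prop⟩
  map₂ σ := F.map₂ σ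
  map₂_id f := F.map₂_id f.hom
  map₂_comp σ τ := F.map₂_comp σ τ
  mapId x := isoMk (F.mapId x.obj)
  mapComp f g := isoMk (F.mapComp f.hom g.hom)
  map₂_whisker_left f _ _ σ := F.map₂_whisker_left f.hom σ
  map₂_whisker_right σ h := F.map₂_whisker_right σ h.hom
  map₂_associator f g h := F.map₂_associator f.hom g.hom h.hom
  map₂_left_unitor f := F.map₂_left_unitor f.hom
  map₂_right_unitor f := F.map₂_right_unitor f.hom

/-- Restriction of a pseudotransformation `𝟭 ⟶ F ⋙ G` to a subbicategory. -/
def liftTrans {F : Pseudofunctor B B'} {G : Pseudofunctor B' B}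
    (ζ : Pseudofunctor.StrongTrans (Pseudofunctor.id B) (F.comp G))
    (hP : ∀ x, S.P x → S'.P (F.obj x))
    (hQ : ∀ {x y : B} (f : x ⟶ y), S.P x → S.P y → S.Q f → S'.Q (F.map f))
    (hP' : ∀ x, S'.P x → S.P (G.obj x))
    (hQ' : ∀ {x y : B'} (f : x ⟶ y), S'.P x → S'.P y → S'.Q f → S.Q (G.map f))
    (hζ : ∀ x, S.P x → S.Q (ζ.app x)) :
    Pseudofunctor.StrongTrans (Pseudofunctor.id S.Obj)
      ((lift (S := S) (S' := S') F hP hQ).comp (lift (S := S') (S' := S) G hP' hQ')) where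
  app x := ⟨ζ.app x.obj, hζ _ x.prop⟩
  naturality f := isoMk (ζ.naturality f.hom)
  naturality_naturality σ := ζ.naturality_naturality σ
  naturality_id x := ζ.naturality_id x.obj
  naturality_comp f g := ζ.naturality_comp f.hom g.hom

end SubbicatData

end Subbicategory

/-! ### Type formers -/

/-- `D` has fiberwise limits of shape `J`: the fibers have them, and pullback functors preserve
them. -/
structure HasFiberwiseLimits {C : Type u} [Category.{v} C] {D : DispCat.{w', w} C}
    (K : D.Cleaving) (J : Type) [Category.{0} J] : Prop where
  hasLimits : ∀ x : C, HasLimitsOfShape J (D.Fiber x)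
  preserves : ∀ {x y : C} (f : x ⟶ y), PreservesLimitsOfShape J (K.pullback f)

/-- A displayed functor preserves fiberwise limits of shape `J`. -/
def PreservesFiberwiseLimits {C : Type u₁} [Category.{v₁} C] {C' : Type u₂} [Category.{v₂} C']
    {F : C ⥤ C'} {D : DispCat.{w₁', w₁} C} {D' : DispCat.{w₂', w₂} C'} (F' : DispFunctor F D D')
    (J : Type) [Category.{0} J] : Prop :=
  ∀ x : C, PreservesLimitsOfShape J (F'.fiber x)

/-- The left Beck-Chevalley condition for a square `α : R₁ ⋙ G ⟶ H ⋙ R₂` and left adjoints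
`L₁ ⊣ R₁` and `L₂ ⊣ R₂`: the mate `G ⋙ L₂ ⟶ L₁ ⋙ H` is invertible. -/
def LeftBeckChevalley {C₁ : Type u} [Category.{v} C₁] {C₂ : Type u₁} [Category.{v₁} C₂]
    {C₃ : Type u₂} [Category.{v₂} C₃] {C₄ : Type u₃} [Category.{v₃} C₄] {G : C₁ ⥤ C₃}
    {H : C₂ ⥤ C₄} {L₁ : C₁ ⥤ C₂} {R₁ : C₂ ⥤ C₁} {L₂ : C₃ ⥤ C₄} {R₂ : C₄ ⥤ C₃}
    (adj₁ : L₁ ⊣ R₁) (adj₂ : L₂ ⊣ R₂) (α : R₁ ⋙ G ⟶ H ⋙ R₂) : Prop :=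
  IsIso ((mateEquiv adj₁ adj₂).symm (TwoSquare.mk R₁ H G R₂ α)).natTrans

/-- Strong dependent sums: left adjoints of weakening, the Beck-Chevalley condition for all
pullback squares of projections, and invertibility of the pairing morphism
`x.a.b ⟶ x.(Σ a b)`. -/
structure StrongSums (X : CompData.{v, u}) (K : X.D.Cleaving) where
  sum : ∀ {x : X.C} (a : X.D.Obj x), X.D.Fiber (X.ext a) ⥤ X.D.Fiber x
  adj : ∀ {x : X.C} (a : X.D.Obj x), sum a ⊣ K.pullback (X.π a)
  beckChevalley : ∀ {x x' : X.C} (a : X.D.Obj x) (a' : X.D.Obj x') (r : x' ⟶ x)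
    (s : X.ext a' ⟶ X.ext a) (h : IsPullback s (X.π a') (X.π a) r),
    LeftBeckChevalley (adj a) (adj a') (K.square h.w)
  strong : ∀ {x : X.C} (a : X.D.Obj x) (b : X.D.Fiber (X.ext a)),
    IsIso (X.extMap (f := 𝟙 (X.ext a)) ((adj a).unit.app b) ≫
      X.extMap (K.lift (X.π a) ((sum a).obj b)))

/-- DFL comprehension categories: full comprehension categories that are democratic and have unit
types, binary product types, equalizer types, and strong dependent sums. -/
structure IsDFL (X : CompData.{v, u}) : Prop where
  terminal : HasTerminal X.C
  cartesian : X.χ.IsCartesian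
  full : X.χ.FullyFaithful
  types : ∃ K : X.D.Cleaving,
    HasFiberwiseLimits K (Discrete PEmpty.{1}) ∧
    HasFiberwiseLimits K (Discrete WalkingPair) ∧
    HasFiberwiseLimits K WalkingParallelPair ∧
    Nonempty (StrongSums X K)
  unit : ∀ {x : X.C} (t : X.D.Fiber x), IsTerminal t → IsIso (X.π t)
  democratic : ∀ {t : X.C}, IsTerminal t → ∀ x : X.C, ∃ a : X.D.Obj t, Nonempty (x ≅ X.ext a)

/-- Morphisms of DFL comprehension categories. -/
structure IsDFLHom {X Y : CompData.{v, u}} (f : CompData.Hom X Y) : Prop where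
  terminal : PreservesLimitsOfShape (Discrete PEmpty.{1}) f.F
  cartesian : f.F'.IsCartesian
  unit : PreservesFiberwiseLimits f.F' (Discrete PEmpty.{1})
  prod : PreservesFiberwiseLimits f.F' (Discrete WalkingPair)
  eq : PreservesFiberwiseLimits f.F' WalkingParallelPair

theorem preservesFiberwiseLimits_id {C : Type u} [Category.{v} C] (D : DispCat.{w', w} C)
    (J : Type) [Category.{0} J] : PreservesFiberwiseLimits (DispFunctor.id D) J := by
  intro x
  have e : 𝟭 (D.Fiber x) ≅ (DispFunctor.id D).fiber x :=
    NatIso.ofComponents (fun a => Iso.refl a) (fun {a b} φ => by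
      have h₀ : D.tr ((𝟭 C).map_id x) (a := a) (b := b) φ = φ := eq_of_heq (D.tr_heq _ _)
      have h : ((DispFunctor.id D).fiber x).map φ = φ := h₀
      rw [h]
      exact (Category.comp_id _).trans (Category.id_comp _).symm)
  exact preservesLimitsOfShape_of_natIso e

theorem preservesFiberwiseLimits_comp {C : Type u₁} [Category.{v₁} C] {C' : Type u₂}
    [Category.{v₂} C'] {C'' : Type u₃} [Category.{v₃} C''] {D : DispCat.{w₁', w₁} C}
    {D' : DispCat.{w₂', w₂} C'} {D'' : DispCat.{w₃', w₃} C''} {F : C ⥤ C'} {G : C' ⥤ C''}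
    (F' : DispFunctor F D D') (G' : DispFunctor G D' D'') (J : Type) [Category.{0} J]
    (hF : PreservesFiberwiseLimits F' J) (hG : PreservesFiberwiseLimits G' J) :
    PreservesFiberwiseLimits (F'.comp G') J := by
  intro x
  have := hF x
  have := hG (F.obj x)
  have e : F'.fiber x ⋙ G'.fiber (F.obj x) ≅ (F'.comp G').fiber x :=
    NatIso.ofComponents (fun a => Iso.refl (G'.obj (F'.obj a) : D''.Fiber (G.obj (F.obj x))))
      (fun {a b} φ => by
        have h : (F'.fiber x ⋙ G'.fiber (F.obj x)).map φ = ((F'.comp G').fiber x).map φ :=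
          eq_of_heq ((D''.tr_heq _ _).trans
            ((G'.map_heq (F.map_id x).symm (D'.tr_heq _ _)).trans (D''.tr_heq _ _).symm))
        rw [h]
        exact (Category.comp_id _).trans (Category.id_comp _).symm)
  exact preservesLimitsOfShape_of_natIso e

theorem isDFLHom_id (X : CompData.{v, u}) : IsDFLHom (CompData.Hom.id X) where
  terminal := inferInstanceAs (PreservesLimitsOfShape _ (𝟭 X.C))
  cartesian := fun _ _ _ _ _ _ h => h
  unit := preservesFiberwiseLimits_id _ _
  prod := preservesFiberwiseLimits_id _ _
  eq := preservesFiberwiseLimits_id _ _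

theorem isDFLHom_comp {X Y Z : CompData.{v, u}} (f : CompData.Hom X Y) (g : CompData.Hom Y Z)
    (hf : IsDFLHom f) (hg : IsDFLHom g) : IsDFLHom (f.comp g) where
  terminal := by
    have := hf.terminal
    have := hg.terminal
    exact inferInstanceAs (PreservesLimitsOfShape _ (f.F ⋙ g.F))
  cartesian := fun _ _ _ _ _ _ h => hg.cartesian _ (hf.cartesian _ h)
  unit := preservesFiberwiseLimits_comp _ _ _ hf.unit hg.unit
  prod := preservesFiberwiseLimits_comp _ _ _ hf.prod hg.prod
  eq := preservesFiberwiseLimits_comp _ _ _ hf.eq hg.eq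

/-! ### The bicategories and the pseudotransformation -/

/-- DFL comprehension categories and their morphisms, inside all comprehension functors. -/
def dflData : SubbicatData CompData.{v, u} where
  P := IsDFL
  Q := IsDFLHom
  id := isDFLHom_id
  comp := isDFLHom_comp

/-- The bicategory of DFL comprehension categories. -/
abbrev DFLCompCat : Type (max (u + 1) (v + 1)) := dflData.{v, u}.Obj

/-- Categories with finite limits and functors preserving them, inside all categories. -/
def finLimData : SubbicatData Cat.{v, u} where
  P C := HasFiniteLimits C
  Q F := PreservesFiniteLimits F.toFunctor
  id C := inferInstanceAs (PreservesFiniteLimits (𝟭 C))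
  comp F G _ _ := comp_preservesFiniteLimits F.toFunctor G.toFunctor

/-- The bicategory of categories with finite limits. -/
abbrev FinLim : Type (max (u + 1) (v + 1)) := finLimData.{v, u}.Obj

/-- `𝟭 : arr C ⟶ arr C` is a DFL comprehension category if `C` has finite limits, and a functor
preserving finite limits induces a morphism of DFL comprehension categories. -/
structure ArrRestricts : Prop where
  obj : ∀ C : Cat.{v, u}, finLimData.P C → dflData.P (arrPseudo.obj C)
  map : ∀ {C C' : Cat.{v, u}} (F : C ⟶ C'), finLimData.P C → finLimData.P C' →
    finLimData.Q F → dflData.Q (arrPseudo.map F)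

/-- The category of contexts of a DFL comprehension category has finite limits, and morphisms of
DFL comprehension categories preserve them. -/
structure BaseRestricts : Prop where
  obj : ∀ X : CompData.{v, u}, dflData.P X → finLimData.P (basePseudo.obj X)
  map : ∀ {X Y : CompData.{v, u}} (f : X ⟶ Y), dflData.P X → dflData.P Y →
    dflData.Q f → finLimData.Q (basePseudo.map f)

/-- The morphisms `(𝟭, χ)` are morphisms of DFL comprehension categories. -/
def CounitRestricts : Prop :=
  ∀ X : CompData.{v, u}, dflData.P X → dflData.Q (counitData.app X)

/-- The pseudofunctor `H` from categories with finite limits to DFL comprehension categories, which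
sends `C` to `𝟭 : arr C ⟶ arr C`. -/
def H (h : ArrRestricts.{v, u}) : Pseudofunctor FinLim.{v, u} DFLCompCat.{v, u} :=
  SubbicatData.lift arrPseudo h.obj h.map

/-- The pseudofunctor `U` from DFL comprehension categories to categories with finite limits, which
sends `χ : D ⟶ arr C` to `C`. -/
def U (h : BaseRestricts.{v, u}) : Pseudofunctor DFLCompCat.{v, u} FinLim.{v, u} :=
  SubbicatData.lift basePseudo h.obj h.map

/-- The pseudotransformation `ζ : 𝟭 ⟶ U ⋙ H`, given by `(𝟭, χ)`. -/
noncomputable def ζ (hH : ArrRestricts.{v, u}) (hU : BaseRestricts.{v, u})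
    (hζ : CounitRestricts.{v, u}) :
    Pseudofunctor.StrongTrans (Pseudofunctor.id DFLCompCat.{v, u}) ((U hU).comp (H hH)) :=
  SubbicatData.liftTrans counitData hU.obj hU.map hH.obj hH.map hζ

/-- A category is univalent if the map from equalities of objects to isomorphisms is bijective. -/
def IsUnivalentCat (C : Type u) [Category.{v} C] : Prop :=
  ∀ x y : C, Function.Bijective (fun e : x = y => eqToIso e)

/-- A comprehension category is univalent if its category of contexts and its displayed category
are univalent. A displayed category is univalent if and only if its fibers are, as displayed
isomorphisms over an identity are isomorphisms in the fiber. -/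
def CompData.IsUnivalent (X : CompData.{v, u}) : Prop :=
  IsUnivalentCat X.C ∧ ∀ x : X.C, IsUnivalentCat (X.D.Fiber x)

/-- A 1-cell of a bicategory is an adjoint equivalence. -/
def IsAdjointEquivalence {B : Type u₁} [Bicategory.{w₁, v₁} B] {x y : B} (f : x ⟶ y) : Prop :=
  ∃ e : Bicategory.Equivalence x y, e.hom = f

end CompLang

/-!
A DFL comprehension category `χ : D ⟶ arr C` is determined by `C`, because on the fiber over `x`
the functor `χ` is an equivalence with the slice category over `x`
(`CompLang.CompData.isEquivalence_fiber`). As `χ` is fully faithful, what has to be shown is that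
every morphism `g : y ⟶ x` is isomorphic to a projection
(`CompLang.CompData.exists_iso_projection`). By democracy, `y` and `x` are extensions of the
terminal context, and `{j : y | g j = i}`, for `i : x`, is an equalizer type over `x` of two
morphisms between weakened closed types. Its extension has the universal property of the equalizer
in `C`, since maps into an extension amount to maps out of the unit type in the fibers, and pullback
functors preserve equalizers (`CompLang.CompData.exists_fiberExt_fork_lift`).

Fullness and democracy also make context extension an equivalence from the fiber over the terminal
context to `C` (`CompLang.CompData.isEquivalence_extFunctor`), which equips `C` with finite limits
and shows that morphisms of DFL comprehension categories preserve them. Conversely, if `C` has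
finite limits, then the fibers of `arr C` are the slice categories, and composition with `f` is left
adjoint to pullback along `f` (`CompLang.arrAdj`). This yields the limits and their stability, and
the strong dependent sums, for which the Beck-Chevalley condition is the pasting lemma for pullback
squares (`CompLang.arr_beckChevalley`).

A choice of types for all arrows gives a pseudo morphism inverse to `(𝟭, χ)`
(`CompLang.CompData.counitInverse`). A 2-cell into a full comprehension category is determined by
its base component, which may be any natural transformation (`CompLang.CompData.isoOfNatIso`). Both
composites have an identity as base functor, so they are isomorphic to identities, and an
equivalence in a bicategory can be upgraded to an adjoint equivalence.
-/

namespace CompLang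

/-! ### The displayed category of arrows -/

section Arrow

variable {C : Type u} [Category.{v} C]

/-- An object of a fiber of the displayed category of arrows, from a morphism. -/
def arrMk {x d : C} (p : d ⟶ x) : (arr C).Fiber x :=
  (⟨d, p⟩ : ArrObj x)

/-- The domain of an object of a fiber of the displayed category of arrows. -/
def arrDom {x : C} (a : (arr C).Fiber x) : C :=
  ArrObj.dom (y := x) a

/-- The morphism that is an object of a fiber of the displayed category of arrows. -/
def arrProj {x : C} (a : (arr C).Fiber x) : arrDom a ⟶ x :=
  ArrObj.hom (y := x) a

/-- The morphism of domains underlying a morphism of a fiber of the displayed category of arrows. -/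
def arrLeft {x : C} {a b : (arr C).Fiber x} (φ : a ⟶ b) : arrDom a ⟶ arrDom b :=
  ArrHom.left (f := 𝟙 x) (a := a) (b := b) φ

theorem arrLeft_comp {x : C} {a b c : (arr C).Fiber x} (φ : a ⟶ b) (ψ : b ⟶ c) :
    arrLeft (φ ≫ ψ) = arrLeft φ ≫ arrLeft ψ :=
  ArrHom.left_eq (Category.id_comp (𝟙 x)).symm ((arr C).fiber_comp_heq φ ψ)

theorem arr_fiber_hom_ext {x : C} {a b : (arr C).Fiber x} {φ ψ : a ⟶ b}
    (h : arrLeft φ = arrLeft ψ) : φ = ψ :=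
  ArrHom.ext h

/-- A morphism of a fiber of the displayed category of arrows, from a commutative triangle. -/
def arrFiberHomMk {x : C} {a b : (arr C).Fiber x} (l : arrDom a ⟶ arrDom b)
    (w : l ≫ arrProj b = arrProj a) : a ⟶ b :=
  (⟨l, w.trans (Category.comp_id _).symm⟩ : ArrHom (𝟙 x) a b)

theorem arrLeft_w {x : C} {a b : (arr C).Fiber x} (φ : a ⟶ b) :
    arrLeft φ ≫ arrProj b = arrProj a :=
  (ArrHom.w (f := 𝟙 x) (a := a) (b := b) φ).trans (Category.comp_id _)

/-- An isomorphism of arrows over `x`, from an isomorphism of their domains. -/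
def arrFiberIsoMk {x : C} {a b : (arr C).Fiber x} (e : arrDom a ≅ arrDom b)
    (w : e.hom ≫ arrProj b = arrProj a) : a ≅ b where
  hom := arrFiberHomMk e.hom w
  inv := arrFiberHomMk e.inv (by rw [← w, e.inv_hom_id_assoc])
  hom_inv_id := arr_fiber_hom_ext ((arrLeft_comp _ _).trans e.hom_inv_id)
  inv_hom_id := arr_fiber_hom_ext ((arrLeft_comp _ _).trans e.inv_hom_id)

/-- An isomorphism of arrows over `x` restricts to an isomorphism of the domains. -/
def arrFiberDomIso {x : C} {a b : (arr C).Fiber x} (e : a ≅ b) :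
    arrDom a ≅ arrDom b where
  hom := arrLeft e.hom
  inv := arrLeft e.inv
  hom_inv_id := (arrLeft_comp _ _).symm.trans (congrArg arrLeft e.hom_inv_id)
  inv_hom_id := (arrLeft_comp _ _).symm.trans (congrArg arrLeft e.inv_hom_id)

theorem arr_fiber_isIso {x : C} {a b : (arr C).Fiber x} (φ : a ⟶ b)
    [IsIso (arrLeft φ)] : IsIso φ :=
  (arrFiberIsoMk (asIso (arrLeft φ)) (arrLeft_w φ)).isIso_hom

/-- The fibers of the displayed category of arrows are the slice categories. -/
def arrFiberToOver (x : C) : (arr C).Fiber x ⥤ Over x where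
  obj a := Over.mk (arrProj a)
  map φ := Over.homMk (arrLeft φ) (arrLeft_w φ)
  map_comp φ ψ := by
    ext
    exact arrLeft_comp φ ψ

instance (x : C) : (arrFiberToOver x).Faithful where
  map_injective h := arr_fiber_hom_ext (congrArg CommaMorphism.left h)

instance (x : C) : (arrFiberToOver x).Full where
  map_surjective f := ⟨arrFiberHomMk f.left (Over.w f), rfl⟩

instance (x : C) : (arrFiberToOver x).EssSurj where
  mem_essImage f := ⟨⟨f.left, f.hom⟩, ⟨Iso.refl _⟩⟩

instance (x : C) : (arrFiberToOver x).IsEquivalence where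

/-- Cartesian morphisms of arrows are pullback squares. -/
theorem arr_isCartesian_iff {x y : C} {f : x ⟶ y} {a : ArrObj x} {b : ArrObj y}
    (φ : ArrHom f a b) :
    (arr C).IsCartesian (a := a) (b := b) φ ↔ IsPullback φ.left a.hom b.hom f := by
  constructor
  · -- A cone with apex `t` is a morphism of arrows out of the identity of `t`.
    intro h
    refine ⟨⟨φ.w⟩, ⟨PullbackCone.IsLimit.mk _
      (fun s => ((h (t := s.pt) (⟨s.pt, 𝟙 _⟩ : ArrObj s.pt) s.snd
        (⟨s.fst, by rw [s.condition]; simp⟩ : ArrHom (s.snd ≫ f) _ b)).choose :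
          ArrHom _ _ _).left) (fun s => ?_) (fun s => ?_) (fun s m hm hm' => ?_)⟩⟩
    · exact congrArg ArrHom.left (h (t := s.pt) (⟨s.pt, 𝟙 _⟩ : ArrObj s.pt) s.snd
        (⟨s.fst, by rw [s.condition]; simp⟩ : ArrHom (s.snd ≫ f) _ b)).choose_spec.1
    · exact (ArrHom.w _).trans (Category.id_comp _)
    · exact congrArg ArrHom.left
        ((h (t := s.pt) (⟨s.pt, 𝟙 _⟩ : ArrObj s.pt) s.snd
          (⟨s.fst, by rw [s.condition]; simp⟩ : ArrHom (s.snd ≫ f) _ b)).choose_spec.2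
          (⟨m, by rw [hm']; simp⟩ : ArrHom s.snd ⟨s.pt, 𝟙 _⟩ a) (ArrHom.ext (by exact hm)))
  · intro h t c g ψ
    change ArrHom (g ≫ f) c b at ψ
    refine ⟨(⟨h.lift ψ.left (ArrObj.hom c ≫ g) (by rw [ψ.w, Category.assoc]),
      h.lift_snd _ _ _⟩ : ArrHom g c a), ArrHom.ext (h.lift_fst _ _ _), ?_⟩
    intro (θ : ArrHom g c a) hθ
    apply ArrHom.ext
    apply h.hom_ext
    · rw [h.lift_fst]
      exact congrArg ArrHom.left hθ
    · rw [h.lift_snd, θ.w]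

variable (C) in
/-- Chosen pullbacks form a cleaving of the displayed category of arrows. -/
noncomputable def arrCleaving [HasPullbacks C] : (arr C).Cleaving where
  obj f b := ⟨pullback (ArrObj.hom b) f, pullback.snd _ _⟩
  lift _ _ := ⟨pullback.fst _ _, pullback.condition⟩
  cart _ _ := (arr_isCartesian_iff _).2 (IsPullback.of_hasPullback _ _)

/-- Composition with `f`, as a functor between fibers. -/
def arrSum {x y : C} (f : x ⟶ y) : (arr C).Fiber x ⥤ (arr C).Fiber y where
  obj a := arrMk (arrProj a ≫ f)
  map {a b} φ := arrFiberHomMk (arrLeft (a := a) (b := b) φ) (by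
    change arrLeft φ ≫ arrProj b ≫ f = arrProj a ≫ f
    rw [← Category.assoc, arrLeft_w])
  map_id _ := rfl
  map_comp φ ψ := arr_fiber_hom_ext (by
    refine Eq.trans ?_ (arrLeft_comp _ _).symm
    exact arrLeft_comp φ ψ)

/-- The upper side of the Cartesian lift of `f` in the displayed category of arrows. -/
def arrLift (K : (arr C).Cleaving) {x y : C} (f : x ⟶ y) (b : (arr C).Fiber y) :
    arrDom ((K.pullback f).obj b) ⟶ arrDom b :=
  ArrHom.left (K.lift f b)

theorem arrLift_isPullback (K : (arr C).Cleaving) {x y : C} (f : x ⟶ y) (b : (arr C).Fiber y) :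
    IsPullback (arrLift K f b) (arrProj ((K.pullback f).obj b)) (arrProj b) f :=
  (arr_isCartesian_iff _).1 (K.cart f b)

theorem arrLift_natural (K : (arr C).Cleaving) {x y : C} (f : x ⟶ y)
    {b c : (arr C).Fiber y} (φ : b ⟶ c) :
    arrLeft ((K.pullback f).map φ) ≫ arrLift K f c = arrLift K f b ≫ arrLeft φ :=
  ArrHom.left_eq ((Category.id_comp f).trans (Category.comp_id f).symm) (K.pullback_map_lift f φ)

/-- Morphisms `arrSum f a ⟶ b` are the same as morphisms `a ⟶ f^* b`, by the universal property
of the pullback. -/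
noncomputable def arrSumHomEquiv (K : (arr C).Cleaving) {x y : C} (f : x ⟶ y)
    (a : (arr C).Fiber x) (b : (arr C).Fiber y) :
    ((arrSum f).obj a ⟶ b) ≃ (a ⟶ (K.pullback f).obj b) where
  toFun ψ := arrFiberHomMk
    ((arrLift_isPullback K f b).lift (arrLeft ψ) (arrProj a) (arrLeft_w ψ))
    ((arrLift_isPullback K f b).lift_snd _ _ _)
  invFun θ := arrFiberHomMk (a := (arrSum f).obj a) (b := b)
    (arrLeft (a := a) (b := (K.pullback f).obj b) θ ≫ arrLift K f b) (by
    change (arrLeft θ ≫ arrLift K f b) ≫ arrProj b = arrProj a ≫ f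
    rw [Category.assoc, (arrLift_isPullback K f b).w, ← Category.assoc, arrLeft_w])
  left_inv ψ := arr_fiber_hom_ext
    ((arrLift_isPullback K f b).lift_fst (arrLeft ψ) (arrProj a) (arrLeft_w ψ))
  right_inv θ := arr_fiber_hom_ext ((arrLift_isPullback K f b).hom_ext
    ((arrLift_isPullback K f b).lift_fst (arrLeft θ ≫ arrLift K f b) (arrProj a) _)
    (((arrLift_isPullback K f b).lift_snd (arrLeft θ ≫ arrLift K f b) (arrProj a) _).trans
      (arrLeft_w θ).symm))

theorem arrSumHomEquiv_lift (K : (arr C).Cleaving) {x y : C} (f : x ⟶ y)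
    {a : (arr C).Fiber x} {b : (arr C).Fiber y} (ψ : (arrSum f).obj a ⟶ b) :
    arrLeft (arrSumHomEquiv K f a b ψ) ≫ arrLift K f b = arrLeft ψ :=
  (arrLift_isPullback K f b).lift_fst (arrLeft ψ) (arrProj a) (arrLeft_w ψ)

/-- Composition with `f` is left adjoint to pullback along `f`. -/
noncomputable def arrAdj (K : (arr C).Cleaving) {x y : C} (f : x ⟶ y) :
    arrSum f ⊣ K.pullback f :=
  Adjunction.mkOfHomEquiv
    { homEquiv := arrSumHomEquiv K f
      homEquiv_naturality_left_symm := fun {a' a b} g θ => arr_fiber_hom_ext (by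
        refine Eq.trans ?_ (arrLeft_comp _ _).symm
        have h : arrLeft (g ≫ θ) ≫ arrLift K f b = arrLeft g ≫ arrLeft θ ≫ arrLift K f b := by
          rw [arrLeft_comp, Category.assoc]
        exact h)
      homEquiv_naturality_right := fun {a b c} ψ g => arr_fiber_hom_ext (by
        refine (arrLift_isPullback K f c).hom_ext ?_ ((arrLeft_w _).trans (arrLeft_w _).symm)
        rw [arrSumHomEquiv_lift, arrLeft_comp, arrLeft_comp, Category.assoc, arrLift_natural,
          ← Category.assoc, arrSumHomEquiv_lift]
        rfl) }

theorem arrAdj_unit_lift (K : (arr C).Cleaving) {x y : C} (f : x ⟶ y) (a : (arr C).Fiber x) :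
    arrLeft ((arrAdj K f).unit.app a) ≫ arrLift K f ((arrSum f).obj a) = 𝟙 (arrDom a) := by
  have h : (arrAdj K f).unit.app a = arrSumHomEquiv K f a _ (𝟙 _) := by
    rw [← Adjunction.homEquiv_id, arrAdj, Adjunction.mkOfHomEquiv_homEquiv]
  have h' := arrSumHomEquiv_lift K f (𝟙 ((arrSum f).obj a))
  rw [← h] at h'
  exact h'

theorem arrLeft_square_lift (K : (arr C).Cleaving) {x' x z' z : C} {s : x' ⟶ x} {p : x ⟶ z}
    {q : x' ⟶ z'} {r : z' ⟶ z} (w : s ≫ p = q ≫ r) (b : (arr C).Fiber z) :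
    arrLeft ((K.square w).app b) ≫ arrLift K q ((K.pullback r).obj b) ≫ arrLift K r b =
      arrLift K s ((K.pullback p).obj b) ≫ arrLift K p b :=
  (Category.assoc _ _ _).symm.trans
    (ArrHom.left_eq (by rw [Category.id_comp, w]) (K.squareApp_lift w b))

/-- The mate of the canonical transformation is compatible with the upper sides of pullback
squares; by the pasting lemma it compares two pullbacks of the same cospan. -/
theorem arr_beckChevalley (K : (arr C).Cleaving) {x' x z' z : C} {s : x' ⟶ x} {p : x ⟶ z}
    {q : x' ⟶ z'} {r : z' ⟶ z} (h : IsPullback s q p r) :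
    LeftBeckChevalley (arrAdj K p) (arrAdj K q) (K.square h.w) := by
  unfold LeftBeckChevalley
  set m := ((mateEquiv (arrAdj K p) (arrAdj K q)).symm
    (TwoSquare.mk (K.pullback p) (K.pullback r) (K.pullback s) (K.pullback q)
      (K.square h.w))).natTrans
  suffices ∀ b, IsIso (m.app b) from NatIso.isIso_of_isIso_app _
  intro b
  let c := (arrSum p).obj b
  let u : b ⟶ (K.pullback p).obj c := (arrAdj K p).unit.app b
  let θ : (arrSum q).obj ((K.pullback s).obj b) ⟶ (K.pullback r).obj c := m.app b
  let l : arrDom ((K.pullback s).obj b) ⟶ arrDom ((K.pullback r).obj c) := arrLeft θ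
  have e : (K.pullback s).map u ≫ (K.square h.w).app c =
      (arrAdj K q).unit.app ((K.pullback s).obj b) ≫ (K.pullback q).map θ :=
    unit_mateEquiv_symm (arrAdj K p) (arrAdj K q)
      (TwoSquare.mk (K.pullback p) (K.pullback r) (K.pullback s) (K.pullback q) (K.square h.w)) b
  have hu : arrLeft u ≫ arrLift K p c = 𝟙 (arrDom b) := arrAdj_unit_lift K p b
  have hl : arrLeft ((arrAdj K q).unit.app ((K.pullback s).obj b)) ≫
      arrLift K q ((arrSum q).obj ((K.pullback s).obj b)) = 𝟙 (arrDom ((K.pullback s).obj b)) :=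
    arrAdj_unit_lift K q _
  have e₁ : l = arrLeft ((K.pullback s).map u ≫ (K.square h.w).app c) ≫
      arrLift K q ((K.pullback r).obj c) := by
    rw [e, arrLeft_comp, Category.assoc, arrLift_natural, ← Category.assoc]
    exact ((congrArg (· ≫ l) hl).trans (Category.id_comp l)).symm
  -- By the triangle identity `hu`, the unit cancels against the lift of `p`.
  have key : l ≫ arrLift K r c = arrLift K s b := by
    have hs : arrLeft ((K.pullback s).map u) ≫ arrLift K s ((K.pullback p).obj c) =
        arrLift K s b ≫ arrLeft u := arrLift_natural K s u
    have hsq := arrLeft_square_lift K h.w c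
    rw [e₁, arrLeft_comp, Category.assoc, Category.assoc]
    refine (congrArg (arrLeft ((K.pullback s).map u) ≫ ·) hsq).trans ?_
    refine (Category.assoc _ _ _).symm.trans ((congrArg (· ≫ arrLift K p c) hs).trans ?_)
    exact (Category.assoc _ _ _).trans
      ((congrArg (arrLift K s b ≫ ·) hu).trans (Category.comp_id _))
  have hw : l ≫ arrProj ((K.pullback r).obj c) = arrProj ((K.pullback s).obj b) ≫ q :=
    arrLeft_w θ
  have P₁ : IsPullback (arrLift K s b) (arrProj ((K.pullback s).obj b) ≫ q) (arrProj b ≫ p) r :=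
    (arrLift_isPullback K s b).paste_vert h
  have P₂ : IsPullback (arrLift K r c) (arrProj ((K.pullback r).obj c)) (arrProj b ≫ p) r :=
    arrLift_isPullback K r c
  have hiso : l = (P₁.isoIsPullback _ _ P₂).hom := P₂.hom_ext
    (key.trans (P₁.isoIsPullback_hom_fst _ _ P₂).symm)
    (hw.trans (P₁.isoIsPullback_hom_snd _ _ P₂).symm)
  have : IsIso (arrLeft θ) := by
    change IsIso l
    rw [hiso]
    infer_instance
  exact arr_fiber_isIso θ

end Arrow

/-! ### Categories with finite limits as DFL comprehension categories -/

section

variable {C : Type u} [Category.{v} C]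

instance arr_fiber_hasFiniteLimits [HasFiniteLimits C] (x : C) :
    HasFiniteLimits ((arr C).Fiber x) where
  out _ _ _ := Adjunction.hasLimitsOfShape_of_equivalence (arrFiberToOver x)

theorem arr_hasFiberwiseLimits [HasFiniteLimits C] (K : (arr C).Cleaving) (J : Type)
    [Category.{0} J] [FinCategory J] : HasFiberwiseLimits K J where
  hasLimits _ := inferInstance
  preserves f := (arrAdj K f).rightAdjoint_preservesLimits.preservesLimitsOfShape

/-- Dependent sums of arrows are given by composition with the projection. The extensions `x.a.b`
and `x.(Σ a b)` are both the domain of `b`, and the pairing morphism is its identity. -/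
noncomputable def arrStrongSums (K : (arr C).Cleaving) : StrongSums (arrObj C) K where
  sum a := arrSum ((arrObj C).π a)
  adj a := arrAdj K ((arrObj C).π a)
  beckChevalley _ _ _ _ h := arr_beckChevalley K h
  strong {x} a b := by
    have h := arrAdj_unit_lift K ((arrObj C).π a) b
    have : IsIso (arrLeft ((arrAdj K ((arrObj C).π a)).unit.app b) ≫
        arrLift K ((arrObj C).π a) ((arrSum ((arrObj C).π a)).obj b)) := by
      rw [h]
      exact IsIso.id (arrDom b)
    exact this

theorem arr_isIso_of_isTerminal {x : C} (t : (arr C).Fiber x) (ht : IsTerminal t) :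
    IsIso (arrProj t) := by
  have hid : IsTerminal (arrMk (𝟙 x)) := by
    refine IsTerminal.ofUniqueHom (fun a => arrFiberHomMk (arrProj a) (Category.comp_id _)) ?_
    intro a φ
    exact arr_fiber_hom_ext ((Category.comp_id _).symm.trans (arrLeft_w φ))
  let e : arrDom t ≅ x := arrFiberDomIso (ht.uniqueUpToIso hid)
  have h : e.hom ≫ 𝟙 x = arrProj t := arrLeft_w (ht.uniqueUpToIso hid).hom
  rw [← h]
  infer_instance

theorem isDFL_arrObj [HasFiniteLimits C] : IsDFL (arrObj C) where
  terminal := inferInstanceAs (HasTerminal C)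
  cartesian _ _ _ _ _ _ h := h
  full _ _ _ _ _ := Function.bijective_id
  types := ⟨arrCleaving C, arr_hasFiberwiseLimits _ _, arr_hasFiberwiseLimits _ _,
    arr_hasFiberwiseLimits _ _, ⟨arrStrongSums _⟩⟩
  unit t ht := arr_isIso_of_isTerminal t ht
  democratic ht x := ⟨arrMk (ht.from x), ⟨Iso.refl x⟩⟩

variable {C' : Type u₁} [Category.{v₁} C']

/-- The terminal object of a slice is an identity, and pullbacks in a slice are computed in the
ambient category. -/
theorem over_post_preservesFiniteLimits [HasFiniteLimits C] (F : C ⥤ C')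
    [PreservesFiniteLimits F] (x : C) : PreservesFiniteLimits (Over.post (X := x) F) := by
  have : PreservesLimitsOfShape WalkingCospan (Over.post (X := x) F) := by
    have : PreservesLimitsOfShape WalkingCospan (Over.post (X := x) F ⋙ Over.forget (F.obj x)) :=
      inferInstanceAs (PreservesLimitsOfShape WalkingCospan (Over.forget x ⋙ F))
    exact preservesLimitsOfShape_of_reflects_of_preserves _ (Over.forget (F.obj x))
  have : PreservesLimitsOfShape (Discrete PEmpty.{1}) (Over.post (X := x) F) := by
    have : PreservesLimit (Functor.empty.{0} (Over x)) (Over.post (X := x) F) := by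
      refine preservesTerminal_of_iso _ ?_
      have h : IsTerminal ((Over.post (X := x) F).obj (Over.mk (𝟙 x))) :=
        Over.mkIdTerminal.ofIso (Over.isoMk (Iso.refl _) ((Category.id_comp _).trans (F.map_id x)))
      exact (h.ofIso ((Over.post F).mapIso
        (Over.mkIdTerminal.uniqueUpToIso terminalIsTerminal))).uniqueUpToIso terminalIsTerminal
    exact preservesLimitsOfShape_pempty_of_preservesTerminal _
  exact preservesFiniteLimits_of_preservesTerminal_and_pullbacks _

theorem arrMap_fiber_preservesFiniteLimits [HasFiniteLimits C] (F : C ⥤ C')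
    [PreservesFiniteLimits F] (x : C) : PreservesFiniteLimits ((arrMap F).fiber x) := by
  have := over_post_preservesFiniteLimits F x
  have e : arrFiberToOver x ⋙ Over.post F ≅ (arrMap F).fiber x ⋙ arrFiberToOver (F.obj x) :=
    NatIso.ofComponents (fun a => Over.isoMk (Iso.refl (F.obj (arrDom a))) (Category.id_comp _))
      (fun {a b} φ => by
        ext
        have h : F.map (arrLeft φ) = arrLeft (((arrMap F).fiber x).map φ) :=
          ArrHom.left_eq (F.map_id x) ((arr C').tr_heq (F.map_id x)
            ((arrMap F).map (f := 𝟙 x) (a := a) (b := b) φ)).symm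
        exact (Category.comp_id _).trans (h.trans (Category.id_comp _).symm))
  have := preservesFiniteLimits_of_natIso e
  exact preservesFiniteLimits_of_reflects_of_preserves _ (arrFiberToOver (F.obj x))

theorem arrMap_isCartesian (F : C ⥤ C') [PreservesLimitsOfShape WalkingCospan F] :
    (arrMap F).IsCartesian := by
  intro x y f a b φ h
  exact (arr_isCartesian_iff _).2 (((arr_isCartesian_iff φ).1 h).map F)

end

theorem isDFLHom_arrHom {C C' : Type u} [Category.{v} C] [Category.{v} C'] [HasFiniteLimits C]
    (F : C ⥤ C') [PreservesFiniteLimits F] : IsDFLHom (arrHom F) where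
  terminal := inferInstanceAs (PreservesLimitsOfShape _ F)
  cartesian := arrMap_isCartesian F
  unit x := (arrMap_fiber_preservesFiniteLimits F x).preservesFiniteLimits _
  prod x := (arrMap_fiber_preservesFiniteLimits F x).preservesFiniteLimits _
  eq x := (arrMap_fiber_preservesFiniteLimits F x).preservesFiniteLimits _

theorem arrRestricts : ArrRestricts.{v, u} where
  obj C h := by
    have : HasFiniteLimits C := h
    exact isDFL_arrObj (C := C)
  map {C _} F hC _ hF := by
    have : HasFiniteLimits C := hC
    have : PreservesFiniteLimits F.toFunctor := hF
    exact isDFLHom_arrHom F.toFunctor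

/-- By univalence of `C`, an isomorphism over `x` comes from an equality of domains, along which the
arrows are equal as well. -/
theorem isUnivalentCat_arr_fiber {C : Type u} [Category.{v} C] (hC : IsUnivalentCat C) (x : C) :
    IsUnivalentCat ((arr C).Fiber x) := by
  intro a b
  refine ⟨fun _ _ _ => rfl, fun e => ?_⟩
  obtain ⟨p, hp⟩ := (hC (arrDom a) (arrDom b)).2 (arrFiberDomIso e)
  have hl : arrLeft e.hom = eqToHom p := by
    have h := congrArg Iso.hom hp
    exact h.symm
  have hw := arrLeft_w e.hom
  obtain ⟨d, q⟩ : ArrObj x := a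
  obtain ⟨d', q'⟩ : ArrObj x := b
  obtain rfl : d = d' := p
  obtain rfl : q = q' := by
    rw [hl] at hw
    exact hw.symm.trans (Category.id_comp _)
  exact ⟨rfl, Iso.ext (arr_fiber_hom_ext hl.symm)⟩

namespace CompData

/-! ### Full comprehension categories -/

section Full

variable {X : CompData.{v, u}}

theorem heq_of_extMap_eq (hX : X.χ.FullyFaithful) {x y : X.C} {f g : x ⟶ y} (h : f = g)
    {a : X.D.Obj x} {b : X.D.Obj y}
    {φ : X.D.Hom f a b} {ψ : X.D.Hom g a b} (e : X.extMap φ = X.extMap ψ) : HEq φ ψ := by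
  subst h
  exact heq_of_eq ((hX f a b).1 (ArrHom.ext e))

theorem exists_extMap_eq (hX : X.χ.FullyFaithful) {x y : X.C} {f : x ⟶ y}
    {a : X.D.Obj x} {b : X.D.Obj y}
    (k : X.ext a ⟶ X.ext b) (w : k ≫ X.π b = X.π a ≫ f) :
    ∃ φ : X.D.Hom f a b, X.extMap φ = k := by
  obtain ⟨φ, hφ⟩ := (hX f a b).2 (⟨k, w⟩ : ArrHom f (X.χ.obj a) (X.χ.obj b))
  exact ⟨φ, congrArg ArrHom.left hφ⟩

/-- The displayed morphism over `f` whose extension is a given morphism over `f`. -/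
noncomputable def homOfExt (hX : X.χ.FullyFaithful) {x y : X.C} {f : x ⟶ y}
    {a : X.D.Obj x} {b : X.D.Obj y}
    (k : X.ext a ⟶ X.ext b) (w : k ≫ X.π b = X.π a ≫ f) : X.D.Hom f a b :=
  (exists_extMap_eq hX k w).choose

theorem extMap_homOfExt (hX : X.χ.FullyFaithful) {x y : X.C} {f : x ⟶ y}
    {a : X.D.Obj x} {b : X.D.Obj y}
    (k : X.ext a ⟶ X.ext b) (w : k ≫ X.π b = X.π a ≫ f) : X.extMap (homOfExt hX k w) = k :=
  (exists_extMap_eq hX k w).choose_spec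

/-- A fully faithful comprehension functor reflects Cartesian morphisms. -/
theorem isCartesian_of_isPullback (hX : X.χ.FullyFaithful) {x y : X.C} {f : x ⟶ y}
    {a : X.D.Obj x} {b : X.D.Obj y}
    {φ : X.D.Hom f a b} (h : IsPullback (X.extMap φ) (X.π a) (X.π b) f) :
    X.D.IsCartesian φ := by
  intro t c g ψ
  have w : X.extMap ψ ≫ X.π b = (X.π c ≫ g) ≫ f := by rw [X.extMap_π, Category.assoc]
  refine ⟨homOfExt hX (h.lift (X.extMap ψ) (X.π c ≫ g) w) (h.lift_snd _ _ _), ?_, ?_⟩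
  · refine eq_of_heq (heq_of_extMap_eq hX rfl ?_)
    rw [X.extMap_comp, extMap_homOfExt, h.lift_fst]
  · intro θ hθ
    refine eq_of_heq (heq_of_extMap_eq hX rfl ?_)
    rw [extMap_homOfExt]
    apply h.hom_ext
    · rw [h.lift_fst, ← X.extMap_comp]
      exact congrArg X.extMap hθ
    · rw [h.lift_snd, X.extMap_π]

end Full

section Fiber

variable (X : CompData.{v, u})

/-- The action of the comprehension functor on the morphisms of a fiber. -/
def fiberExt {x : X.C} {a b : X.D.Fiber x} (φ : a ⟶ b) : X.ext a ⟶ X.ext b :=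
  X.extMap (f := 𝟙 x) (a := a) (b := b) φ

theorem fiberExt_id {x : X.C} (a : X.D.Fiber x) : X.fiberExt (𝟙 a) = 𝟙 (X.ext a) :=
  X.extMap_id a

theorem fiberExt_comp {x : X.C} {a b c : X.D.Fiber x} (φ : a ⟶ b) (ψ : b ⟶ c) :
    X.fiberExt (φ ≫ ψ) = X.fiberExt φ ≫ X.fiberExt ψ :=
  (X.extMap_heq (Category.id_comp (𝟙 x)).symm (X.D.fiber_comp_heq φ ψ)).trans (X.extMap_comp _ _)

theorem fiberExt_π {x : X.C} {a b : X.D.Fiber x} (φ : a ⟶ b) :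
    X.fiberExt φ ≫ X.π b = X.π a :=
  (X.extMap_π (f := 𝟙 x) (a := a) (b := b) φ).trans (Category.comp_id _)

/-- The action of the comprehension functor on the Cartesian lift of `f`. -/
noncomputable def liftExt (K : X.D.Cleaving) {x y : X.C} (f : x ⟶ y) (b : X.D.Fiber y) :
    X.ext ((K.pullback f).obj b) ⟶ X.ext b :=
  X.extMap (K.lift f b)

theorem liftExt_natural (K : X.D.Cleaving) {x y : X.C} (f : x ⟶ y) {a b : X.D.Fiber y}
    (φ : a ⟶ b) :
    X.fiberExt ((K.pullback f).map φ) ≫ X.liftExt K f b = X.liftExt K f a ≫ X.fiberExt φ := by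
  refine (X.extMap_comp _ _).symm.trans (Eq.trans ?_ (X.extMap_comp _ _))
  exact X.extMap_heq ((Category.id_comp f).trans (Category.comp_id f).symm)
    (K.pullback_map_lift f φ)

variable {X}

theorem fiberExt_injective (hX : X.χ.FullyFaithful) {x : X.C} {a b : X.D.Fiber x} {φ ψ : a ⟶ b}
    (h : X.fiberExt φ = X.fiberExt ψ) : φ = ψ :=
  eq_of_heq (heq_of_extMap_eq hX rfl h)

/-- The morphism of a fiber whose extension is a given morphism over the base. -/
noncomputable def fiberHomOfExt (hX : X.χ.FullyFaithful) {x : X.C} {a b : X.D.Fiber x}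
    (k : X.ext a ⟶ X.ext b) (w : k ≫ X.π b = X.π a) : a ⟶ b :=
  homOfExt hX (f := 𝟙 x) (a := a) (b := b) k (w.trans (Category.comp_id _).symm)

theorem fiberExt_fiberHomOfExt (hX : X.χ.FullyFaithful) {x : X.C} {a b : X.D.Fiber x}
    (k : X.ext a ⟶ X.ext b) (w : k ≫ X.π b = X.π a) : X.fiberExt (fiberHomOfExt hX k w) = k :=
  extMap_homOfExt hX _ _

theorem isPullback_liftExt (hX : X.χ.IsCartesian) (K : X.D.Cleaving) {x y : X.C} (f : x ⟶ y)
    (b : X.D.Fiber y) :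
    IsPullback (X.liftExt K f b) (X.π ((K.pullback f).obj b)) (X.π b) f :=
  (arr_isCartesian_iff (X.χ.map (K.lift f b))).1 (hX _ (K.cart f b))

theorem arrLeft_fiber_map {x : X.C} {a b : X.D.Fiber x} (φ : a ⟶ b) :
    arrLeft ((X.χ.fiber x).map φ) = X.fiberExt φ :=
  ArrHom.left_eq rfl ((arr X.C).tr_heq ((𝟭 X.C).map_id x) (X.χ.map (f := 𝟙 x) (a := a) (b := b) φ))

theorem faithful_fiber (hX : X.χ.FullyFaithful) (x : X.C) : (X.χ.fiber x).Faithful where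
  map_injective h := fiberExt_injective hX (by rw [← arrLeft_fiber_map, ← arrLeft_fiber_map, h])

theorem full_fiber (hX : X.χ.FullyFaithful) (x : X.C) : (X.χ.fiber x).Full where
  map_surjective φ := ⟨fiberHomOfExt hX (arrLeft φ) (arrLeft_w φ), arr_fiber_hom_ext
    ((arrLeft_fiber_map _).trans (fiberExt_fiberHomOfExt hX _ _))⟩

/-- If the base functors of two pseudo morphisms into a full comprehension category are related by
a natural transformation, then there is a 2-cell over it: its components are determined by
compatibility with the comparisons. -/
noncomputable def hom₂OfNatTrans {X Y : CompData.{v, u}} (hY : Y.χ.FullyFaithful) {f g : Hom X Y}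
    (τ : f.F ⟶ g.F) : Hom₂ f g where
  nat := τ
  nat' :=
    { app := fun {x} a => homOfExt hY (f := τ.app x)
        (f.invComparison a ≫ τ.app (X.ext a) ≫ g.comparison a) (by
          rw [Category.assoc, Category.assoc, g.comparison_π, ← τ.naturality, ← Category.assoc,
            f.invComparison_π])
      naturality := fun {x y k a b} φ => heq_of_extMap_eq hY (τ.naturality k) (by
        rw [Y.extMap_comp, Y.extMap_comp, extMap_homOfExt, extMap_homOfExt, ← Category.assoc,
          f.invComparison_natural, Category.assoc, Category.assoc, Category.assoc,
          ← g.comparison_natural, ← Category.assoc (f.F.map _), τ.naturality, Category.assoc]) }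
  compat a := by
    rw [extMap_homOfExt, ← Category.assoc, f.comparison_inv, Category.id_comp]

/-- 2-cells into a full comprehension category are determined by their base component. -/
theorem Hom₂.ext_base {X Y : CompData.{v, u}} (hY : Y.χ.FullyFaithful) {f g : Hom X Y}
    {σ τ : Hom₂ f g} (h : σ.nat = τ.nat) : σ = τ :=
  Hom₂.ext_heq (fun x => by rw [h]) (fun {x} a => heq_of_extMap_eq hY (by rw [h]) (by
    rw [← cancel_epi (f.comparison a), σ.compat, τ.compat, h]))

/-- Pseudo morphisms into a full comprehension category are isomorphic if their base functors
are. -/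
noncomputable def isoOfNatIso {X Y : CompData.{v, u}} (hY : Y.χ.FullyFaithful) {f g : X ⟶ Y}
    (e : Hom.F f ≅ Hom.F g) : f ≅ g where
  hom := hom₂OfNatTrans hY e.hom
  inv := hom₂OfNatTrans hY e.inv
  hom_inv_id := Hom₂.ext_base hY e.hom_inv_id
  inv_hom_id := Hom₂.ext_base hY e.inv_hom_id

/-- A morphism into an extension that equalizes two vertical morphisms lifts to the extension of
their equalizer. By the unit type, a morphism `k : z ⟶ x.a` over `s` amounts to a morphism
`1 ⟶ s^* a` in the fiber over `z`, and `s^*` preserves the equalizer. -/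
theorem exists_fiberExt_fork_lift (hX : X.χ.FullyFaithful) (K : X.D.Cleaving) {z x : X.C}
    {a b c : X.D.Fiber x} {u v : a ⟶ b} {ι : c ⟶ a} {w : ι ≫ u = ι ≫ v}
    (hι : IsLimit (Fork.ofι ι w)) (k : z ⟶ X.ext a)
    [PreservesLimitsOfShape WalkingParallelPair (K.pullback (k ≫ X.π a))] (t : X.D.Fiber z)
    [IsIso (X.π t)] (hk : k ≫ X.fiberExt u = k ≫ X.fiberExt v) :
    ∃ l : z ⟶ X.ext c, l ≫ X.fiberExt ι = k := by
  set s := k ≫ X.π a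
  let φ : X.D.Hom s t a := homOfExt hX (X.π t ≫ k) (Category.assoc _ _ _)
  have hφ : X.extMap φ = X.π t ≫ k := extMap_homOfExt hX _ _
  let φ₀ : t ⟶ (K.pullback s).obj a := (K.cart s a).factor (Category.id_comp s).symm φ
  have hφ₀ : X.fiberExt φ₀ ≫ X.liftExt K s a = X.π t ≫ k := by
    refine (X.extMap_comp _ _).symm.trans (Eq.trans ?_ hφ)
    exact X.extMap_heq (Category.id_comp s) ((K.cart s a).factor_comp _ _)
  have hu : ∀ u : a ⟶ b, X.fiberExt (φ₀ ≫ (K.pullback s).map u) ≫ X.liftExt K s b =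
      X.π t ≫ k ≫ X.fiberExt u := fun u => by
    rw [X.fiberExt_comp, Category.assoc, X.liftExt_natural, ← Category.assoc, hφ₀,
      Category.assoc]
  have he : φ₀ ≫ (K.pullback s).map u = φ₀ ≫ (K.pullback s).map v := by
    refine (K.cart s b).hom_ext (heq_of_extMap_eq hX rfl ?_)
    refine (X.extMap_comp _ _).trans (Eq.trans ?_ (X.extMap_comp _ _).symm)
    exact (hu u).trans ((congrArg (X.π t ≫ ·) hk).trans (hu v).symm)
  obtain ⟨ψ, hψ⟩ : ∃ ψ : t ⟶ (K.pullback s).obj c, ψ ≫ (K.pullback s).map ι = φ₀ :=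
    let l := Fork.IsLimit.lift' (isLimitForkMapOfIsLimit (K.pullback s) w hι) φ₀ he
    ⟨l.1, l.2⟩
  refine ⟨inv (X.π t) ≫ X.fiberExt ψ ≫ X.liftExt K s c, ?_⟩
  rw [Category.assoc, Category.assoc, ← X.liftExt_natural, ← Category.assoc (X.fiberExt ψ),
    ← X.fiberExt_comp, hψ, hφ₀, IsIso.inv_hom_id_assoc]

end Fiber

/-! ### Contexts and closed types -/

section Democracy

variable {X : CompData.{v, u}}

variable (X) in
/-- Context extension of `t` as a functor on the fiber over `t`. -/
def extFunctor (t : X.C) : X.D.Fiber t ⥤ X.C where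
  obj a := X.ext a
  map φ := X.fiberExt φ
  map_id a := X.fiberExt_id a
  map_comp φ ψ := X.fiberExt_comp φ ψ

/-- Every morphism between extensions of the terminal context is a morphism over that context, and
by democracy every context is such an extension. -/
theorem isEquivalence_extFunctor (hX : IsDFL X) {t : X.C} (ht : IsTerminal t) :
    (X.extFunctor t).IsEquivalence where
  faithful := ⟨fun h => fiberExt_injective hX.full h⟩
  full := ⟨fun k => ⟨fiberHomOfExt hX.full k (ht.hom_ext _ _), fiberExt_fiberHomOfExt hX.full _ _⟩⟩
  essSurj := ⟨fun x => by
    obtain ⟨a, ⟨e⟩⟩ := hX.democratic ht x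
    exact ⟨a, ⟨e.symm⟩⟩⟩

theorem fiber_hasFiniteLimits (hX : IsDFL X) (x : X.C) : HasFiniteLimits (X.D.Fiber x) := by
  obtain ⟨K, h₁, h₂, h₃, -⟩ := hX.types
  have : HasTerminal (X.D.Fiber x) := h₁.hasLimits x
  have : HasBinaryProducts (X.D.Fiber x) := h₂.hasLimits x
  have : HasEqualizers (X.D.Fiber x) := h₃.hasLimits x
  have : HasFiniteProducts (X.D.Fiber x) := hasFiniteProducts_of_has_binary_and_terminal
  exact hasFiniteLimits_of_hasEqualizers_and_finite_products

/-- The category of contexts is equivalent to the fiber over the terminal context. -/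
theorem base_hasFiniteLimits (hX : IsDFL X) : HasFiniteLimits X.C := by
  have := hX.terminal
  have := isEquivalence_extFunctor hX terminalIsTerminal
  have := fiber_hasFiniteLimits hX (⊤_ X.C)
  exact ⟨fun J _ _ => Adjunction.hasLimitsOfShape_of_equivalence (X.extFunctor (⊤_ X.C)).inv⟩

/-- Under the equivalences of categories of contexts with fibers over terminal contexts, the base
functor corresponds to the functor between these fibers. -/
theorem base_preservesFiniteLimits {Y : CompData.{v, u}} (hX : IsDFL X) (hY : IsDFL Y)
    {f : Hom X Y} (hf : IsDFLHom f) : PreservesFiniteLimits f.F := by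
  have := hX.terminal
  have := hf.terminal
  let t := ⊤_ X.C
  have ht : IsTerminal (f.F.obj t) := terminalIsTerminal.isTerminalObj f.F t
  have := isEquivalence_extFunctor hX (terminalIsTerminal (C := X.C))
  have := isEquivalence_extFunctor hY ht
  have := fiber_hasFiniteLimits hX t
  have : PreservesFiniteLimits (f.F'.fiber t) := by
    have := hf.unit t
    have := hf.prod t
    have := hf.eq t
    have := PreservesFiniteProducts.of_preserves_binary_and_terminal (f.F'.fiber t)
    exact preservesFiniteLimits_of_preservesEqualizers_and_finiteProducts _
  have e : f.F'.fiber t ⋙ Y.extFunctor (f.F.obj t) ≅ X.extFunctor t ⋙ f.F :=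
    (NatIso.ofComponents (fun a => ⟨f.comparison a, f.invComparison a, f.comparison_inv a,
        f.inv_comparison a⟩) (fun {a b} φ => by
      refine (Hom.comparison_natural f (g := 𝟙 t) (a := a) (b := b) φ).trans ?_
      refine congrArg (f.comparison a ≫ ·) ?_
      exact Y.extMap_heq (f.F.map_id t) (Y.D.tr_heq (f.F.map_id t) _).symm)).symm
  have := comp_preservesFiniteLimits (f.F'.fiber t) (Y.extFunctor (f.F.obj t))
  have := preservesFiniteLimits_of_natIso e
  have := comp_preservesFiniteLimits (X.extFunctor t).inv (X.extFunctor t ⋙ f.F)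
  exact preservesFiniteLimits_of_natIso (F := (X.extFunctor t).inv ⋙ X.extFunctor t ⋙ f.F)
    ((Functor.associator _ _ _).symm ≪≫
      Functor.isoWhiskerRight (X.extFunctor t).asEquivalence.counitIso f.F ≪≫ f.F.leftUnitor)

end Democracy

/-! ### Every morphism is a projection -/

/-- In a DFL comprehension category, every morphism is isomorphic to a projection. By democracy,
`y` and `x` are extensions of the terminal context by closed types `y'` and `x'`, and `g` comes from
a morphism `y' ⟶ x'`. Over `x`, the type of those `j : y` with `g j = i`, for `i : x`, is the
equalizer of two morphisms from the weakening of `y'` to the weakening of `x'`: one sends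
`(i, j)` to `(i, g j)`, the other to `(i, i)`. -/
theorem exists_iso_projection {X : CompData.{v, u}} (hX : IsDFL X) {x y : X.C} (g : y ⟶ x) :
    ∃ (a : X.D.Obj x) (e : X.ext a ≅ y), e.hom ≫ g = X.π a := by
  have := hX.terminal
  obtain ⟨K, h₁, -, h₃, -⟩ := hX.types
  let p : x ⟶ ⊤_ X.C := terminal.from x
  obtain ⟨y', ⟨ey⟩⟩ := hX.democratic terminalIsTerminal y
  obtain ⟨x', ⟨ex⟩⟩ := hX.democratic terminalIsTerminal x
  change X.D.Fiber (⊤_ X.C) at x' y'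
  let γ : y' ⟶ x' := fiberHomOfExt hX.full (ey.inv ≫ g ≫ ex.hom) (terminalIsTerminal.hom_ext _ _)
  have hγ : X.fiberExt γ = ey.inv ≫ g ≫ ex.hom := fiberExt_fiberHomOfExt _ _ _
  let a := (K.pullback p).obj y'
  let b := (K.pullback p).obj x'
  have Pa : IsPullback (X.liftExt K p y') (X.π a) (X.π y') p :=
    isPullback_liftExt hX.cartesian _ _ _
  have Pb : IsPullback (X.liftExt K p x') (X.π b) (X.π x') p :=
    isPullback_liftExt hX.cartesian _ _ _
  let γ' : a ⟶ b := (K.pullback p).map γ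
  have hγ' : X.fiberExt γ' ≫ X.liftExt K p x' = X.liftExt K p y' ≫ ey.inv ≫ g ≫ ex.hom := by
    rw [← hγ]
    exact X.liftExt_natural K p γ
  let δ : a ⟶ b := fiberHomOfExt hX.full
    (Pb.lift (X.π a ≫ ex.hom) (X.π a) (terminalIsTerminal.hom_ext _ _)) (Pb.lift_snd _ _ _)
  have hδ : X.fiberExt δ ≫ X.liftExt K p x' = X.π a ≫ ex.hom := by
    rw [fiberExt_fiberHomOfExt]
    exact Pb.lift_fst _ _ _
  have : HasEqualizers (X.D.Fiber x) := h₃.hasLimits x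
  let ι : equalizer γ' δ ⟶ a := equalizer.ι γ' δ
  have hι : X.fiberExt ι ≫ X.fiberExt γ' = X.fiberExt ι ≫ X.fiberExt δ := by
    rw [← X.fiberExt_comp, ← X.fiberExt_comp, equalizer.condition]
  have hιπ : X.fiberExt ι ≫ X.π a = X.π (equalizer γ' δ) := X.fiberExt_π ι
  let q : X.ext (equalizer γ' δ) ⟶ y := X.fiberExt ι ≫ X.liftExt K p y' ≫ ey.inv
  have hq : q ≫ g = X.π (equalizer γ' δ) := by
    have h : (X.fiberExt ι ≫ X.π a) ≫ ex.hom = q ≫ g ≫ ex.hom := by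
      rw [Category.assoc, ← hδ, ← Category.assoc, ← hι, Category.assoc, hγ']
      simp only [q, Category.assoc]
    rw [← cancel_mono ex.hom, ← hιπ, h, Category.assoc]
  let m : y ⟶ X.ext a := Pa.lift ey.hom g (terminalIsTerminal.hom_ext _ _)
  have hm₁ : m ≫ X.liftExt K p y' = ey.hom := Pa.lift_fst _ _ _
  have hm₂ : m ≫ X.π a = g := Pa.lift_snd _ _ _
  have hm : m ≫ X.fiberExt γ' = m ≫ X.fiberExt δ := by
    apply Pb.hom_ext
    · rw [Category.assoc, Category.assoc, hγ', hδ, ← Category.assoc, hm₁, ← Category.assoc m, hm₂,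
        ey.hom_inv_id_assoc]
    · rw [Category.assoc, Category.assoc, X.fiberExt_π, X.fiberExt_π]
  have : HasTerminal (X.D.Fiber y) := h₁.hasLimits y
  have : IsIso (X.π (⊤_ X.D.Fiber y)) := hX.unit _ terminalIsTerminal
  have := h₃.preserves (m ≫ X.π a)
  obtain ⟨r, hr⟩ := exists_fiberExt_fork_lift hX.full K (equalizerIsEqualizer γ' δ) m
    (⊤_ X.D.Fiber y) hm
  have hrq : r ≫ q = 𝟙 y := by
    change r ≫ X.fiberExt ι ≫ X.liftExt K p y' ≫ ey.inv = _
    have hr' : r ≫ X.fiberExt ι = m := hr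
    rw [← Category.assoc r, hr', ← Category.assoc, hm₁, ey.hom_inv_id]
  have hqm : q ≫ m = X.fiberExt ι := by
    apply Pa.hom_ext
    · simp [q, hm₁]
    · rw [Category.assoc, hm₂, hq, hιπ]
  have hrπ : (q ≫ r) ≫ X.π (equalizer γ' δ) = X.π (equalizer γ' δ) := by
    have hr' : r ≫ X.fiberExt ι = m := hr
    rw [← hιπ, Category.assoc, ← Category.assoc r, hr', ← Category.assoc, hqm]
  -- As `q ≫ r` comes from the fiber, it suffices that it agrees with the identity after composition
  -- with the monomorphism `ι`.
  have hqr : q ≫ r = 𝟙 _ := by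
    let ρ : equalizer γ' δ ⟶ equalizer γ' δ := fiberHomOfExt hX.full (q ≫ r) hrπ
    have hρ : X.fiberExt ρ = q ≫ r := fiberExt_fiberHomOfExt _ _ _
    have hρι : ρ ≫ ι = 𝟙 _ ≫ ι := fiberExt_injective hX.full (by
      rw [X.fiberExt_comp, hρ, Category.id_comp, Category.assoc]
      exact (congrArg (q ≫ ·) hr).trans hqm)
    have hρ₁ : ρ = 𝟙 _ := equalizer.hom_ext hρι
    rw [← hρ, hρ₁, X.fiberExt_id]
  exact ⟨equalizer γ' δ, ⟨q, r, hqr, hrq⟩, hq⟩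

/-- On fibers, the comprehension functor is an equivalence with the slice category. -/
theorem isEquivalence_fiber {X : CompData.{v, u}} (hX : IsDFL X) (x : X.C) :
    (X.χ.fiber x).IsEquivalence where
  faithful := faithful_fiber hX.full x
  full := full_fiber hX.full x
  essSurj := ⟨fun b => by
    obtain ⟨a, e, h⟩ := exists_iso_projection hX (arrProj b)
    exact ⟨a, ⟨arrFiberIsoMk e h⟩⟩⟩

theorem isDFLHom_counitApp {X : CompData.{v, u}} (hX : IsDFL X) : IsDFLHom (counitApp X) where
  terminal := inferInstanceAs (PreservesLimitsOfShape _ (𝟭 X.C))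
  cartesian := hX.cartesian
  unit x := by
    have := isEquivalence_fiber hX x
    exact inferInstanceAs (PreservesLimitsOfShape _ (X.χ.fiber x))
  prod x := by
    have := isEquivalence_fiber hX x
    exact inferInstanceAs (PreservesLimitsOfShape _ (X.χ.fiber x))
  eq x := by
    have := isEquivalence_fiber hX x
    exact inferInstanceAs (PreservesLimitsOfShape _ (X.χ.fiber x))

/-! ### The inverse of the comprehension functor -/

section Inverse

variable {X : CompData.{v, u}} (hX : IsDFL X)

/-- A type over `x` whose projection is isomorphic to a given arrow. -/
noncomputable def typeOfArr {x : X.C} (g : ArrObj x) : X.D.Obj x :=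
  (exists_iso_projection hX g.hom).choose

/-- The extension by `typeOfArr g` is the domain of `g`. -/
noncomputable def typeOfArrIso {x : X.C} (g : ArrObj x) : X.ext (typeOfArr hX g) ≅ g.dom :=
  (exists_iso_projection hX g.hom).choose_spec.choose

theorem typeOfArrIso_hom_comp {x : X.C} (g : ArrObj x) :
    (typeOfArrIso hX g).hom ≫ g.hom = X.π (typeOfArr hX g) :=
  (exists_iso_projection hX g.hom).choose_spec.choose_spec

theorem typeOfArrIso_inv_comp {x : X.C} (g : ArrObj x) :
    (typeOfArrIso hX g).inv ≫ X.π (typeOfArr hX g) = g.hom := by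
  rw [← typeOfArrIso_hom_comp, Iso.inv_hom_id_assoc]

theorem typeOfArr_w {x y : X.C} {f : x ⟶ y} {g : ArrObj x} {h : ArrObj y} (φ : ArrHom f g h) :
    ((typeOfArrIso hX g).hom ≫ φ.left ≫ (typeOfArrIso hX h).inv) ≫ X.π (typeOfArr hX h) =
      X.π (typeOfArr hX g) ≫ f := by
  rw [Category.assoc, Category.assoc, typeOfArrIso_inv_comp, φ.w, ← Category.assoc,
    typeOfArrIso_hom_comp]

/-- The displayed functor that sends an arrow to a type with isomorphic projection. -/
noncomputable def arrInverse : DispFunctor (𝟭 X.C) (arr X.C) X.D where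
  obj g := typeOfArr hX g
  map φ := homOfExt hX.full _ (typeOfArr_w hX φ)
  map_id g := heq_of_extMap_eq hX.full rfl (by
    refine (extMap_homOfExt hX.full _ _).trans (Eq.trans ?_ (X.extMap_id _).symm)
    exact (congrArg ((typeOfArrIso hX g).hom ≫ ·) (Category.id_comp _)).trans
      (typeOfArrIso hX g).hom_inv_id)
  map_comp {x y z f g a b c} φ ψ := heq_of_extMap_eq hX.full rfl (by
    refine (extMap_homOfExt hX.full _ _).trans (Eq.trans ?_ (X.extMap_comp _ _).symm)
    rw [extMap_homOfExt, extMap_homOfExt]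
    change _ ≫ (ArrHom.left φ ≫ ArrHom.left ψ) ≫ _ = _
    simp)

theorem extMap_arrInverse_map {x y : X.C} {f : x ⟶ y} {g : ArrObj x} {h : ArrObj y}
    (φ : ArrHom f g h) : X.extMap ((arrInverse hX).map (a := g) (b := h) φ) =
      (typeOfArrIso hX g).hom ≫ φ.left ≫ (typeOfArrIso hX h).inv :=
  extMap_homOfExt hX.full _ (typeOfArr_w hX φ)

theorem typeOfArrIso_inv_natural {x y : X.C} {f : x ⟶ y} {g : ArrObj x} {h : ArrObj y}
    (φ : ArrHom f g h) : φ.left ≫ (typeOfArrIso hX h).inv =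
      (typeOfArrIso hX g).inv ≫ X.extMap ((arrInverse hX).map (a := g) (b := h) φ) :=
  ((typeOfArrIso hX g).eq_inv_comp.2 (extMap_arrInverse_map hX φ).symm)

/-- The pseudo morphism from `𝟭 : arr X.C ⟶ arr X.C` to `X` that is inverse to `(𝟭, χ)`. -/
noncomputable def counitInverse : CompData.Hom (arrObj X.C) X where
  F := 𝟭 X.C
  F' := arrInverse hX
  chi :=
    { app := fun {x} g => (⟨(typeOfArrIso hX g).inv,
        (typeOfArrIso_inv_comp hX g).trans (Category.comp_id _).symm⟩ : ArrHom (𝟙 x) _ _)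
      naturality := fun {_ _ k _ _} φ =>
        ArrHom.heq ((idSquare (𝟭 X.C)).naturality k) (typeOfArrIso_inv_natural hX φ) }
  isIso_chi g := (inferInstance : IsIso (typeOfArrIso hX g).inv)

theorem arrInverse_isCartesian : (arrInverse hX).IsCartesian := by
  intro x y f a b φ h
  refine isCartesian_of_isPullback hX.full ?_
  exact ((arr_isCartesian_iff φ).1 h).of_iso (typeOfArrIso hX a).symm (typeOfArrIso hX b).symm
    (Iso.refl _) (Iso.refl _)
    (typeOfArrIso_inv_natural hX φ)
    ((Category.comp_id _).trans (typeOfArrIso_inv_comp hX a).symm)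
    ((Category.comp_id _).trans (typeOfArrIso_inv_comp hX b).symm)
    ((Category.comp_id _).trans (Category.id_comp _).symm)

theorem isEquivalence_arrInverse_fiber (x : X.C) : ((arrInverse hX).fiber x).IsEquivalence := by
  have := isEquivalence_fiber hX x
  have e : 𝟭 ((arr X.C).Fiber x) ≅ (arrInverse hX).fiber x ⋙ X.χ.fiber x :=
    NatIso.ofComponents
      (fun a => arrFiberIsoMk (typeOfArrIso hX a).symm (typeOfArrIso_inv_comp hX a))
      (fun {a b} φ => arr_fiber_hom_ext (by
        rw [arrLeft_comp, arrLeft_comp]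
        refine (typeOfArrIso_inv_natural hX φ).trans ?_
        refine congrArg ((typeOfArrIso hX a).inv ≫ ·) (Eq.trans ?_ (arrLeft_fiber_map _).symm)
        exact X.extMap_heq rfl (X.D.tr_heq rfl ((arrInverse hX).map (f := 𝟙 x) φ)).symm))
  have : ((arrInverse hX).fiber x ⋙ X.χ.fiber x).IsEquivalence :=
    Functor.isEquivalence_of_iso e
  exact Functor.isEquivalence_of_comp_right _ (X.χ.fiber x)

theorem isDFLHom_counitInverse : IsDFLHom (counitInverse hX) where
  terminal := inferInstanceAs (PreservesLimitsOfShape _ (𝟭 X.C))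
  cartesian := arrInverse_isCartesian hX
  unit x := by
    have := isEquivalence_arrInverse_fiber hX x
    exact inferInstanceAs (PreservesLimitsOfShape _ ((arrInverse hX).fiber x))
  prod x := by
    have := isEquivalence_arrInverse_fiber hX x
    exact inferInstanceAs (PreservesLimitsOfShape _ ((arrInverse hX).fiber x))
  eq x := by
    have := isEquivalence_arrInverse_fiber hX x
    exact inferInstanceAs (PreservesLimitsOfShape _ ((arrInverse hX).fiber x))

end Inverse

end CompData

/-! ### The adjoint equivalence -/

theorem baseRestricts : BaseRestricts.{v, u} where
  obj _ hX := CompData.base_hasFiniteLimits hX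
  map _ hX hY hf := CompData.base_preservesFiniteLimits hX hY hf

/-- Both composites of `(𝟭, χ)` and its inverse have the identity as base functor, and therefore
they are isomorphic to identities. -/
theorem isAdjointEquivalence_ζ_app (hH : ArrRestricts.{v, u}) (hU : BaseRestricts.{v, u})
    (hζ : CounitRestricts.{v, u}) (X : DFLCompCat.{v, u}) :
    IsAdjointEquivalence ((ζ hH hU hζ).app X) := by
  let Y : DFLCompCat.{v, u} := (H hH).obj ((U hU).obj X)
  let f : X ⟶ Y := (ζ hH hU hζ).app X
  let g : Y ⟶ X := ⟨CompData.counitInverse X.prop, CompData.isDFLHom_counitInverse X.prop⟩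
  let η : 𝟙 X ≅ f ≫ g := SubbicatData.isoMk
    (CompData.isoOfNatIso X.prop.full (Functor.leftUnitor (𝟭 X.obj.C)).symm)
  let ε : g ≫ f ≅ 𝟙 Y := SubbicatData.isoMk
    (CompData.isoOfNatIso Y.prop.full (Functor.leftUnitor (𝟭 X.obj.C)))
  exact ⟨Bicategory.Equivalence.mkOfAdjointifyCounit η ε, rfl⟩

end CompLang

theorem mainTheorem11 :
    ∃ (hH : CompLang.ArrRestricts.{v, u}) (hU : CompLang.BaseRestricts.{v, u})
      (hζ : CompLang.CounitRestricts.{v, u}),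
      (∀ X : CompLang.DFLCompCat.{v, u},
        CompLang.IsAdjointEquivalence ((CompLang.ζ hH hU hζ).app X)) ∧
      (∀ C : CompLang.FinLim.{v, u}, CompLang.IsUnivalentCat C.obj →
        ((CompLang.H hH).obj C).obj.IsUnivalent) :=
  ⟨CompLang.arrRestricts, CompLang.baseRestricts,
    fun _ hX => CompLang.CompData.isDFLHom_counitApp hX,
    CompLang.isAdjointEquivalence_ζ_app _ _ _,
    fun _ hC => ⟨hC, CompLang.isUnivalentCat_arr_fiber hC⟩⟩
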